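/- **Nanophrases.** Let $\alpha_v=\{a_+,a_-,b_+,b_-\}$. An $n$-component nanophrase over $\alpha_v$ is a finite alphabet $\mathcal A$ with a map $\mathcal A\to\alpha_v$, $A\mapsto|A|$, together with a sequence $p=w_1|w_2|\cdots|w_n$ of words on $\mathcal A$ such that every letter of $\mathcal A$ occurs exactly twice in $w_1w_2\cdots w_n$. Let $\tau_v,\nu_v,\sigma_v$ be the involutions of $\alpha_v$ with $\tau_v: a_+\leftrightarrow b_-,\ a_-\leftrightarrow b_+$; $\nu_v: a_\pm\leftrightarrow b_\pm$; $\sigma_v: a_+\leftrightarrow a_-,\ b_+\leftrightarrow b_-$, and let $$S_v=\{(x_s,x_s,x_s),\,(x_s,x_s,x_{-s}),\,(x_s,x_{-s},x_{-s}) : x\in\{a,b\},\ s\in\{+,-\}\}.$$ **$M$-homotopy** is the equivalence relation on $n$-component nanophrases over $\alpha_v$ generated by isomorphisms (bijections of alphabets preserving $|\cdot|$ and carrying the $i$th component to the $i$th component for all $i$) and the following moves, where $x,y,z,t$ in H1–H3 are sequences of letters that may contain bars: - H1: $(\mathcal A, xAAy)\leftrightarrow(\mathcal A\setminus\{A\},xy)$;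 - H2: $(\mathcal A,xAByBAz)\leftrightarrow(\mathcal A\setminus\{A,B\},xyz)$ if $\tau_v(|A|)=|B|$; - H3: $(\mathcal A,xAByACzBCt)\leftrightarrow(\mathcal A,xBAyCAzCBt)$ if $(|A|,|B|,|C|)\in S_v$; - shift move: one component $Ax$ is replaced by $xA$, and $|A|$ is replaced by $\nu_v(|A|)$ if $A$ occurs in $x$ (and is kept otherwise); - self-crossing move: for a letter $A$ that occurs twice in one component, $|A|$ is replaced by $\sigma_v(|A|)$. **The numbers $\mu$.** Let $p=w_1|\cdots|w_n$ be a nanophrase over $\alpha_v$. To an occurrence of a letter $A$ in $w_i$ whose other occurrence lies in $w_k$ assign the sign $\varepsilon=1$ if ($i<k$ and $|A|=b_+$) or ($i>k$ and $|A|=a_+$); $\varepsilon=-1$ if ($i<k$ and $|A|=a_-$) or ($i>k$ and $|A|=b_-$); $\varepsilon=0$ otherwise. Let $w_i^\varepsilon$ be the word on $\mathcal A\cup\mathcal A^{-1}$ obtained from $w_i$ by replacing each letter $A$ by $A^{\varepsilon}$, with $A^0=\emptyset$. For a letter $A$ having an occurrence of non-zero sign, let $k(A)$ be the index of the component that contains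 the other occurrence of $A$, and let $x_A$ be the part of $w_{k(A)}^\varepsilon$ that precedes this other occurrence. On words in the letters of non-zero sign and their formal inverses define letter by letter, without cancellation, $$\rho^2(A^{\pm1})=A^{\pm1},\qquad \rho^q(A^{\pm1})=\rho^{q-1}(x_A^{-1})\,A^{\pm1}\,\rho^{q-1}(x_A)\quad(q\ge3),$$ put $\eta(A^{\pm1})=a_{k(A)}^{\pm1}$, and let $\varphi$ be the multiplicative map from words in $a_1^{\pm1},\dots,a_n^{\pm1}$ to the ring $\mathbb Z[[\kappa_1,\dots,\kappa_n]]$ of formal power series in non-commuting variables with $\varphi(a_h)=1+\kappa_h$ and $\varphi(a_h^{-1})=1-\kappa_h+\kappa_h^2-\cdots$. The coefficient of each monomial in $\varphi(\eta(\rho^q(w_i^\varepsilon)))$ is eventually constant in $q$; define $\mu(p;c_1,\dots,c_u,i)$, for $u\ge1$ and indices between $1$ and $n$, as the limit for $q\to\infty$ of the coefficient of $\kappa_{c_1}\cdots\kappa_{c_u}$. **The residue classes $\bar\mu$.** Let $\Delta(p;c_1,\dots,c_u,i)\ge0$ be the greatest common divisor of all $\mu(p;d_1,\dots,d_t)$ with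 $2\le t\le u$, where $d_1,\dots,d_t$ is obtained from $c_1,\dots,c_u,i$ by eliminating at least one term and permuting the remaining ones cyclically ($\Delta(p;c_1,i)=0$), and let $\bar\mu(p;c_1,\dots,c_u,i)$ be the residue class of $\mu(p;c_1,\dots,c_u,i)$ modulo $\Delta(p;c_1,\dots,c_u,i)$. **Theorem.** Let $p$ and $p'$ be $M$-homotopic $n$-component nanophrases over $\alpha_v$, and let $c_1,\dots,c_u,i$ be pairwise distinct integers between $1$ and $n$. Then $\Delta(p;c_1,\dots,c_u,i)=\Delta(p';c_1,\dots,c_u,i)$ and $\bar\mu(p;c_1,\dots,c_u,i)=\bar\mu(p';c_1,\dots,c_u,i)$. -/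

import Mathlib

open Filter Topology

/-! ### Formal power series in non-commuting variables -/

/-- The formal power series over `ℤ` in the non-commuting variables `κ_h`, `h : σ`. A monomial
`κ_{c₁} ⋯ κ_{c_u}` is the list `[c₁, …, c_u]`; a series is the function that gives the coefficient
of every monomial. -/
def NCSeries (σ : Type*) : Type _ := List σ → ℤ

namespace NCSeries

variable {σ : Type*}

instance : AddCommGroup (NCSeries σ) := inferInstanceAs (AddCommGroup (List σ → ℤ))

/-- The coefficient of a monomial. -/
def coeff (f : NCSeries σ) (c : List σ) : ℤ := f c

@[ext] theorem ext {f g : NCSeries σ} (h : ∀ c, f.coeff c = g.coeff c) : f = g := funext h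

instance : One (NCSeries σ) := ⟨fun c => if c.isEmpty then 1 else 0⟩

/-- The Cauchy product: the monomial `c` is split in all ways as a product of two monomials. -/
instance : Mul (NCSeries σ) :=
  ⟨fun f g c => ∑ k ∈ Finset.range (c.length + 1), f.coeff (c.take k) * g.coeff (c.drop k)⟩

theorem coeff_zero (c : List σ) : (0 : NCSeries σ).coeff c = 0 := rfl
theorem coeff_add (f g : NCSeries σ) (c : List σ) :
    (f + g).coeff c = f.coeff c + g.coeff c := rfl
theorem coeff_one (c : List σ) : (1 : NCSeries σ).coeff c = if c.isEmpty then 1 else 0 := rfl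
theorem coeff_mul (f g : NCSeries σ) (c : List σ) :
    (f * g).coeff c =
      ∑ k ∈ Finset.range (c.length + 1), f.coeff (c.take k) * g.coeff (c.drop k) := rfl

/-- The series whose coefficients are those of the monomials starting with `a`. -/
def shift (a : σ) (f : NCSeries σ) : NCSeries σ := fun c => f.coeff (a :: c)

theorem coeff_mul_nil (f g : NCSeries σ) : (f * g).coeff [] = f.coeff [] * g.coeff [] := by
  simp [coeff_mul]

theorem coeff_mul_cons (f g : NCSeries σ) (a : σ) (c : List σ) :
    (f * g).coeff (a :: c) = f.coeff [] * g.coeff (a :: c) + (shift a f * g).coeff c := by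
  rw [coeff_mul, coeff_mul, List.length_cons, Finset.sum_range_succ']
  simp [shift, coeff, add_comm]

protected theorem add_mul' (f g h : NCSeries σ) : (f + g) * h = f * h + g * h := by
  ext c
  simp only [coeff_add, coeff_mul, add_mul, Finset.sum_add_distrib]

protected theorem mul_add' (f g h : NCSeries σ) : f * (g + h) = f * g + f * h := by
  ext c
  simp only [coeff_add, coeff_mul, mul_add, Finset.sum_add_distrib]

protected theorem mul_assoc' (f g h : NCSeries σ) : f * g * h = f * (g * h) := by
  ext c
  induction c generalizing f g with
  | nil => simp only [coeff_mul_nil, mul_assoc]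
  | cons a c ih =>
    have e : ((shift a (f * g)) * h).coeff c =
        f.coeff [] * (shift a g * h).coeff c + (shift a f * g * h).coeff c := by
      simp only [coeff_mul (shift a (f * g)) h, coeff_mul (shift a g) h,
        coeff_mul (shift a f * g) h, Finset.mul_sum, ← Finset.sum_add_distrib]
      refine Finset.sum_congr rfl fun k _ => ?_
      have : (shift a (f * g)).coeff (c.take k) =
          f.coeff [] * (shift a g).coeff (c.take k) + (shift a f * g).coeff (c.take k) :=
        coeff_mul_cons f g a _
      rw [this]; ring
    rw [coeff_mul_cons, coeff_mul_nil, e, ih, coeff_mul_cons f, coeff_mul_cons g]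
    ring

protected theorem one_mul' (f : NCSeries σ) : 1 * f = f := by
  ext c
  rw [coeff_mul, Finset.sum_eq_single 0]
  · simp [coeff_one]
  · intro k hk hk0
    rw [Finset.mem_range] at hk
    cases c with
    | nil => simp at hk; omega
    | cons a c =>
      cases k with
      | zero => exact absurd rfl hk0
      | succ k => simp [coeff_one]
  · simp

protected theorem mul_one' (f : NCSeries σ) : f * 1 = f := by
  ext c
  rw [coeff_mul, Finset.sum_eq_single c.length]
  · simp [coeff_one]
  · intro k hk hk0
    rw [Finset.mem_range] at hk
    have : (c.drop k).isEmpty = false := by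
      rw [List.isEmpty_eq_false_iff]; intro h; rw [List.drop_eq_nil_iff] at h; omega
    simp [coeff_one, this]
  · simp

instance : Ring (NCSeries σ) :=
  { (inferInstance : AddCommGroup (NCSeries σ)) with
    mul_assoc := NCSeries.mul_assoc'
    one_mul := NCSeries.one_mul'
    mul_one := NCSeries.mul_one'
    left_distrib := NCSeries.mul_add'
    right_distrib := NCSeries.add_mul'
    zero_mul := fun f => by ext c; simp [coeff_mul, coeff_zero]
    mul_zero := fun f => by ext c; simp [coeff_mul, coeff_zero]
    zsmul := fun m f => m • f
    zsmul_zero' := fun f => zero_zsmul f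
    zsmul_succ' := fun m f => by
      simpa using SubNegMonoid.zsmul_succ' m f
    zsmul_neg' := fun m f => by
      simpa using SubNegMonoid.zsmul_neg' m f
    neg_add_cancel := fun f => neg_add_cancel f }

/-- The variable `κ_h`. -/
noncomputable def X (h : σ) : NCSeries σ := open Classical in fun c => if c = [h] then 1 else 0

/-- The geometric series `1 - κ_h + κ_h² - κ_h³ + ⋯`. -/
noncomputable def altGeom (h : σ) : NCSeries σ :=
  open Classical in fun c => if ∀ a ∈ c, a = h then (-1) ^ c.length else 0

end NCSeries

/-! ### Nanophrases -/

/-- Each letter of the alphabet occurs exactly twice in the concatenation of the components. -/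
def IsGaussPhrase {L : Type} {n : ℕ} (w : Fin n → List L) : Prop :=
  open Classical in ∀ A : L, (List.ofFn w).flatten.count A = 2

/-- An `n`-component nanophrase over `α`: a finite alphabet with a projection to `α`, and a Gauss
phrase on this alphabet with the components `word 0 | word 1 | ⋯ | word (n-1)`. -/
structure Nanophrase (α : Type) (n : ℕ) where
  /-- the alphabet -/
  Letter : Type
  finite : Finite Letter
  /-- the projection `A ↦ |A|` -/
  proj : Letter → α
  /-- the components -/
  word : Fin n → List Letter
  gauss : IsGaussPhrase word

/-- A phrase written as one sequence, where the symbol `none` stands for the bar that ends a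
component. -/
def flatPhrase {L : Type} {n : ℕ} (w : Fin n → List L) : List (Option L) :=
  (List.ofFn w).flatMap fun v => v.map some ++ [none]

/-- Homotopy data `(α, τ, S)` with the involutions `ν` (for shift moves) and `σ` (for self crossing
moves). -/
structure MHomotopyData (α : Type) where
  tau : α → α
  tau_invol : Function.Involutive tau
  S : Set (α × α × α)
  nu : α → α
  nu_invol : Function.Involutive nu
  sigma : α → α
  sigma_invol : Function.Involutive sigma

/-- The isomorphisms and the moves that generate `M`-homotopy. In H1, H2, H3 the sequences
`x, y, z, t` may contain bars. -/
inductive MMove {α : Type} (D : MHomotopyData α) {n : ℕ} :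
    Nanophrase α n → Nanophrase α n → Prop
  | iso (p q : Nanophrase α n) (f : p.Letter ≃ q.Letter)
      (hproj : ∀ A, q.proj (f A) = p.proj A)
      (hword : ∀ i, q.word i = (p.word i).map f) : MMove D p q
  /-- `xAAy ⟷ xy` -/
  | h1 {L : Type} (hL : Finite L) (proj : L → α) (w : Fin n → List L) (hw : IsGaussPhrase w)
      (A : L) (hL' : Finite {C : L // C ≠ A})
      (w' : Fin n → List {C : L // C ≠ A}) (hw' : IsGaussPhrase w')
      (x y : List (Option L))
      (h : flatPhrase w = x ++ [some A, some A] ++ y)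
      (h' : (flatPhrase w').map (Option.map Subtype.val) = x ++ y) :
      MMove D ⟨L, hL, proj, w, hw⟩ ⟨{C : L // C ≠ A}, hL', fun C => proj C, w', hw'⟩
  /-- `xAByBAz ⟷ xyz` if `τ(|A|) = |B|` -/
  | h2 {L : Type} (hL : Finite L) (proj : L → α) (w : Fin n → List L) (hw : IsGaussPhrase w)
      (A B : L) (hL' : Finite {C : L // C ≠ A ∧ C ≠ B})
      (w' : Fin n → List {C : L // C ≠ A ∧ C ≠ B}) (hw' : IsGaussPhrase w')
      (x y z : List (Option L))
      (hAB : D.tau (proj A) = proj B)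
      (h : flatPhrase w = x ++ [some A, some B] ++ y ++ [some B, some A] ++ z)
      (h' : (flatPhrase w').map (Option.map Subtype.val) = x ++ y ++ z) :
      MMove D ⟨L, hL, proj, w, hw⟩ ⟨{C : L // C ≠ A ∧ C ≠ B}, hL', fun C => proj C, w', hw'⟩
  /-- `xAByACzBCt ⟷ xBAyCAzCBt` if `(|A|, |B|, |C|) ∈ S` -/
  | h3 {L : Type} (hL : Finite L) (proj : L → α) (w w' : Fin n → List L)
      (hw : IsGaussPhrase w) (hw' : IsGaussPhrase w')
      (A B C : L) (x y z t : List (Option L))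
      (hS : (proj A, proj B, proj C) ∈ D.S)
      (h : flatPhrase w =
        x ++ [some A, some B] ++ y ++ [some A, some C] ++ z ++ [some B, some C] ++ t)
      (h' : flatPhrase w' =
        x ++ [some B, some A] ++ y ++ [some C, some A] ++ z ++ [some C, some B] ++ t) :
      MMove D ⟨L, hL, proj, w, hw⟩ ⟨L, hL, proj, w', hw'⟩
  /-- The `i`th component `Ax` becomes `xA`; `|A|` becomes `ν(|A|)` if `A` occurs in `x`, and
  nothing else changes. (On a component with a single letter this is the identity.) -/
  | shift {L : Type} (hL : Finite L) (proj proj' : L → α) (w w' : Fin n → List L)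
      (hw : IsGaussPhrase w) (hw' : IsGaussPhrase w')
      (i : Fin n) (A : L) (x : List L)
      (h : w i = A :: x) (h' : w' i = x ++ [A]) (hne : ∀ j, j ≠ i → w' j = w j)
      (hA : A ∈ x → proj' A = D.nu (proj A)) (hA' : A ∉ x → proj' A = proj A)
      (hproj : ∀ B, B ≠ A → proj' B = proj B) :
      MMove D ⟨L, hL, proj, w, hw⟩ ⟨L, hL, proj', w', hw'⟩
  /-- The letter `A` occurs twice in the `k`th component, and `|A|` becomes `σ(|A|)`. -/
  | selfCrossing {L : Type} (hL : Finite L) (proj proj' : L → α) (w : Fin n → List L)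
      (hw : IsGaussPhrase w)
      (k : Fin n) (A : L) (x y z : List L)
      (h : w k = x ++ [A] ++ y ++ [A] ++ z)
      (hA : proj' A = D.sigma (proj A)) (hproj : ∀ B, B ≠ A → proj' B = proj B) :
      MMove D ⟨L, hL, proj, w, hw⟩ ⟨L, hL, proj', w, hw⟩

/-- `M`-homotopy of nanophrases. -/
def MHomotopic {α : Type} (D : MHomotopyData α) {n : ℕ} (p q : Nanophrase α n) : Prop :=
  Relation.EqvGen (MMove D) p q

/-! ### The homotopy data of virtual links -/

/-- `α_v = {a₊, a₋, b₊, b₋}` -/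
inductive AlphaV : Type
  | aPlus | aMinus | bPlus | bMinus

namespace AlphaV

/-- `τ_v : a₊ ↔ b₋, a₋ ↔ b₊` -/
def tau : AlphaV → AlphaV
  | aPlus => bMinus
  | bMinus => aPlus
  | aMinus => bPlus
  | bPlus => aMinus

/-- `ν_v : a₊ ↔ b₊, a₋ ↔ b₋` -/
def nu : AlphaV → AlphaV
  | aPlus => bPlus
  | bPlus => aPlus
  | aMinus => bMinus
  | bMinus => aMinus

/-- `σ_v : a₊ ↔ a₋, b₊ ↔ b₋` -/
def sigma : AlphaV → AlphaV
  | aPlus => aMinus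
  | aMinus => aPlus
  | bPlus => bMinus
  | bMinus => bPlus

/-- The set `S_v`. -/
def S : Set (AlphaV × AlphaV × AlphaV) :=
  {(aPlus, aPlus, aPlus), (aPlus, aPlus, aMinus), (aPlus, aMinus, aMinus),
   (aMinus, aMinus, aMinus), (aMinus, aMinus, aPlus), (aMinus, aPlus, aPlus),
   (bPlus, bPlus, bPlus), (bPlus, bPlus, bMinus), (bPlus, bMinus, bMinus),
   (bMinus, bMinus, bMinus), (bMinus, bMinus, bPlus), (bMinus, bPlus, bPlus)}

end AlphaV

/-- `(α_v, τ_v, S_v)` with `ν_v` and `σ_v`. -/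
def virtualData : MHomotopyData AlphaV where
  tau := AlphaV.tau
  tau_invol := fun a => by cases a <;> rfl
  S := AlphaV.S
  nu := AlphaV.nu
  nu_invol := fun a => by cases a <;> rfl
  sigma := AlphaV.sigma
  sigma_invol := fun a => by cases a <;> rfl

/-! ### The numbers `μ` and the residue classes `μ̄` -/

namespace Nanophrase

section Components

variable {α : Type} {n : ℕ} (p : Nanophrase α n)

/-- The components in which the letter `A` occurs. -/
noncomputable def comps (A : p.Letter) : Finset (Fin n) :=
  open Classical in Finset.univ.filter fun i => A ∈ p.word i

theorem comps_nonempty (A : p.Letter) : (p.comps A).Nonempty := by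
  classical
  have h := p.gauss A
  have hm : A ∈ (List.ofFn p.word).flatten := by
    rw [← List.count_pos_iff, h]; norm_num
  rw [List.mem_flatten] at hm
  obtain ⟨l, hl, hA⟩ := hm
  rw [List.mem_ofFn] at hl
  obtain ⟨i, rfl⟩ := hl
  exact ⟨i, by simp [comps, hA]⟩

/-- The component in which the first `A` of the phrase occurs. -/
noncomputable def firstComp (A : p.Letter) : Fin n := (p.comps A).min' (p.comps_nonempty A)

/-- The component in which the second `A` of the phrase occurs. -/
noncomputable def secondComp (A : p.Letter) : Fin n := (p.comps A).max' (p.comps_nonempty A)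

end Components

variable {n : ℕ} (p : Nanophrase AlphaV n)

/-- The sign of the letter `A` of the `i`th component, as a list: `[(A, true)]` is `A`,
`[(A, false)]` is `A⁻¹`, and `[]` is `A⁰ = ∅`. If `A` occurs in the `i`th component and in the `k`th
component, `k ≠ i`, then the other occurrence of `A` is the one in the `k`th component. -/
noncomputable def signedLetter (i : Fin n) (A : p.Letter) : List (p.Letter × Bool) :=
  open Classical in
  if ((∃ k, i < k ∧ A ∈ p.word k) ∧ p.proj A = AlphaV.bPlus) ∨
      ((∃ k, k < i ∧ A ∈ p.word k) ∧ p.proj A = AlphaV.aPlus) then [(A, true)]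
  else if ((∃ k, i < k ∧ A ∈ p.word k) ∧ p.proj A = AlphaV.aMinus) ∨
      ((∃ k, k < i ∧ A ∈ p.word k) ∧ p.proj A = AlphaV.bMinus) then [(A, false)]
  else []

/-- The signed `i`th component `w_i^ε`, a word on the letters and their formal inverses. -/
noncomputable def signedWord (i : Fin n) : List (p.Letter × Bool) :=
  (p.word i).flatMap (p.signedLetter i)

/-- The index `k` with `η(A) = a_k`: the component of the second `A` if `|A|` is `b₊` or `a₋`, the
component of the first `A` if `|A|` is `a₊` or `b₋`. -/
noncomputable def etaIndex (A : p.Letter) : Fin n :=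
  match p.proj A with
  | AlphaV.bPlus => p.secondComp A
  | AlphaV.aMinus => p.secondComp A
  | AlphaV.aPlus => p.firstComp A
  | AlphaV.bMinus => p.firstComp A

/-- The signed word obtained by truncating `w_k^ε` at the letter `A`, where `η(A) = a_k`. For a
letter that appears in a signed component, the `k`th component contains the other occurrence (the
one with sign `0`), and `A` occurs only once in it. -/
noncomputable def truncWord (A : p.Letter) : List (p.Letter × Bool) :=
  open Classical in
  ((p.word (p.etaIndex A)).takeWhile fun B => decide (B ≠ A)).flatMap
    (p.signedLetter (p.etaIndex A))

/-- `p.rho d` is the map `ρ^{d+2}` on words on the letters and their formal inverses: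
`ρ²(A^±) = A^±` and `ρ^{q}(A^±) = ρ^{q-1}(x⁻¹) A^± ρ^{q-1}(x)` with `x = p.truncWord A`. Here
`FreeGroup.invRev` is the formal inverse of a word; nothing is cancelled. -/
noncomputable def rho : ℕ → List (p.Letter × Bool) → List (p.Letter × Bool)
  | 0, l => l
  | d + 1, l => l.flatMap fun a =>
      rho d (FreeGroup.invRev (p.truncWord a.1)) ++ [a] ++ rho d (p.truncWord a.1)

/-- `η`, from words on the letters and their inverses to words on `a_1, …, a_n` and their
inverses. -/
noncomputable def eta (l : List (p.Letter × Bool)) : List (Fin n × Bool) :=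
  l.map fun a => (p.etaIndex a.1, a.2)

end Nanophrase

/-- `φ`, with `φ(a_h) = 1 + κ_h` and `φ(a_h⁻¹) = 1 - κ_h + κ_h² - ⋯`. -/
noncomputable def magnusPhi {n : ℕ} (l : List (Fin n × Bool)) : NCSeries (Fin n) :=
  (l.map fun a => if a.2 then 1 + NCSeries.X a.1 else NCSeries.altGeom a.1).prod

namespace Nanophrase

variable {n : ℕ} (p : Nanophrase AlphaV n)

/-- `μ(p; c₁, …, c_u, i)`, the limit for `q → ∞` of the coefficient of `κ_{c₁} ⋯ κ_{c_u}` in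
`φ(η(ρ^q(w_i^ε)))`. -/
noncomputable def mu (c : List (Fin n)) (i : Fin n) : ℤ :=
  limUnder atTop fun d : ℕ => (magnusPhi (p.eta (p.rho d (p.signedWord i)))).coeff c

/-- `μ(p; d₁, …, d_t)` for a sequence whose last term plays the role of `i`. -/
noncomputable def muSeq (d : List (Fin n)) : ℤ :=
  match d.getLast? with
  | some i => p.mu d.dropLast i
  | none => 0

/-- The sequences of at least two terms that are obtained from `s` by eliminating at least one term
and permuting the remaining ones cyclically. -/
def lowerSeqs (s : List (Fin n)) : Finset (List (Fin n)) :=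
  (s.sublists.toFinset.filter fun d => 2 ≤ d.length ∧ d.length < s.length).biUnion
    fun d => d.cyclicPermutations.toFinset

/-- `Δ(p; c₁, …, c_u, i)`; it is `0` for `u = 1`, as the greatest common divisor of no numbers. -/
noncomputable def Delta (c : List (Fin n)) (i : Fin n) : ℕ :=
  ((lowerSeqs (c ++ [i])).gcd p.muSeq).natAbs

/-- `μ̄(p; c₁, …, c_u, i)`: the residue class of `μ` modulo `Δ`, together with its modulus (two
values are equal iff the moduli agree and the classes agree). -/
noncomputable def muBar (c : List (Fin n)) (i : Fin n) : Σ m : ℕ, ZMod m :=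
  ⟨p.Delta c i, (p.mu c i : ZMod (p.Delta c i))⟩

end Nanophrase

namespace NCSeries

variable {σ : Type*}

theorem coeff_neg (f : NCSeries σ) (c : List σ) : (-f).coeff c = -f.coeff c := rfl
theorem coeff_sub (f g : NCSeries σ) (c : List σ) :
    (f - g).coeff c = f.coeff c - g.coeff c := rfl
theorem coeff_shift (a : σ) (f : NCSeries σ) (c : List σ) :
    (shift a f).coeff c = f.coeff (a :: c) := rfl
theorem coeff_X (h : σ) (c : List σ) :
    (X h).coeff c = open Classical in if c = [h] then 1 else 0 := rfl
theorem coeff_altGeom (h : σ) (c : List σ) :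
    (altGeom h).coeff c = open Classical in if ∀ a ∈ c, a = h then (-1) ^ c.length else 0 := rfl

theorem coeff_X_mul (h : σ) (g : NCSeries σ) (a : σ) (c : List σ) :
    (X h * g).coeff (a :: c) = open Classical in if a = h then g.coeff c else 0 := by
  classical
  have e : shift a (X h) = if a = h then 1 else 0 := by
    ext c
    by_cases hah : a = h <;> simp [coeff_shift, coeff_X, hah, coeff_one, coeff_zero]
  rw [coeff_mul_cons, e]
  by_cases hah : a = h <;> simp [hah, coeff_X, coeff_zero]

theorem altGeom_nil (h : σ) : (altGeom h).coeff [] = 1 := by simp [coeff_altGeom]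

theorem shift_altGeom (h a : σ) :
    shift a (altGeom h) = open Classical in if a = h then -altGeom h else 0 := by
  classical
  ext c
  by_cases hah : a = h
  · by_cases hc : ∀ b ∈ c, b = h
    · simp [coeff_shift, coeff_neg, coeff_altGeom, hah, pow_succ, if_pos hc]
    · simp [coeff_shift, coeff_neg, coeff_altGeom, hah, if_neg hc]
  · simp [coeff_shift, coeff_altGeom, coeff_zero, hah]

theorem one_add_X_mul_altGeom (h : σ) : (1 + X h) * altGeom h = 1 := by
  classical
  ext c
  rw [add_mul, one_mul, coeff_add]
  cases c with
  | nil => simp [coeff_mul_nil, altGeom_nil, coeff_X, coeff_one]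
  | cons a c =>
    rw [coeff_X_mul, ← coeff_shift, shift_altGeom]
    by_cases hah : a = h <;> simp [hah, coeff_one, coeff_neg, coeff_zero]

theorem altGeom_mul_one_add_X (h : σ) : altGeom h * (1 + X h) = 1 := by
  classical
  ext c
  induction c with
  | nil => simp [coeff_mul_nil, altGeom_nil, coeff_add, coeff_X, coeff_one]
  | cons a c ih =>
    rw [coeff_mul_cons, altGeom_nil, shift_altGeom, coeff_add]
    by_cases hah : a = h
    · rw [if_pos hah, neg_mul, coeff_neg, ih]
      cases c <;> simp [coeff_one, coeff_X, hah]
    · simp [hah, coeff_one, coeff_zero, coeff_X]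

/-- `f` and `g` have the same coefficients up to degree `d`. -/
def AgreeUpTo (d : ℕ) (f g : NCSeries σ) : Prop := ∀ c : List σ, c.length ≤ d → f.coeff c = g.coeff c

theorem AgreeUpTo.mul {d : ℕ} {f f' g g' : NCSeries σ} (hf : AgreeUpTo d f f')
    (hg : AgreeUpTo d g g') : AgreeUpTo d (f * g) (f' * g') := by
  intro c hc
  rw [coeff_mul, coeff_mul]
  refine Finset.sum_congr rfl fun k _ => ?_
  rw [hf _ (by simp; omega), hg _ (by simp; omega)]

theorem AgreeUpTo.conj {d : ℕ} {f f' g g' y : NCSeries σ} (hf : AgreeUpTo d f f')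
    (hg : AgreeUpTo d g g') (hy : y.coeff [] = 0) :
    AgreeUpTo (d + 1) (f * y * g) (f' * y * g') := by
  have h1 : AgreeUpTo (d + 1) (f * y) (f' * y) := by
    intro c hc
    rw [coeff_mul, coeff_mul]
    refine Finset.sum_congr rfl fun k hk => ?_
    rw [Finset.mem_range] at hk
    by_cases hkc : k = c.length
    · simp [hkc, hy]
    · rw [hf _ (by simp; omega)]
  have h0 : (f * y).coeff [] = 0 := by rw [coeff_mul_nil, hy, mul_zero]
  have h0' : (f' * y).coeff [] = 0 := by rw [coeff_mul_nil, hy, mul_zero]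
  intro c hc
  rw [coeff_mul, coeff_mul]
  refine Finset.sum_congr rfl fun k hk => ?_
  rcases Nat.eq_zero_or_pos k with rfl | hk0
  · simp [h0, h0']
  · rw [h1 _ (by simp; omega), hg _ (by simp; omega)]

end NCSeries

theorem magnusPhi_append {n : ℕ} (l m : List (Fin n × Bool)) :
    magnusPhi (l ++ m) = magnusPhi l * magnusPhi m := by
  simp [magnusPhi]

theorem magnusPhi_invRev {n : ℕ} (l : List (Fin n × Bool)) :
    magnusPhi (FreeGroup.invRev l) * magnusPhi l = 1 := by
  induction l with
  | nil => simp [magnusPhi, FreeGroup.invRev]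
  | cons a l ih =>
    have e : FreeGroup.invRev (a :: l) = FreeGroup.invRev l ++ [(a.1, !a.2)] := by
      simp [FreeGroup.invRev]
    have e2 : magnusPhi [(a.1, !a.2)] * magnusPhi [a] = 1 := by
      obtain ⟨h, b⟩ := a
      cases b
      · simpa [magnusPhi] using NCSeries.one_add_X_mul_altGeom h
      · simpa [magnusPhi] using NCSeries.altGeom_mul_one_add_X h
    have e3 : magnusPhi (a :: l) = magnusPhi [a] * magnusPhi l := magnusPhi_append [a] l
    rw [e, e3, magnusPhi_append, mul_assoc, ← mul_assoc (magnusPhi [(a.1, !a.2)]), e2, one_mul, ih]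

namespace Nanophrase

variable {n : ℕ} (p : Nanophrase AlphaV n)

theorem rho_append (d : ℕ) (l m : List (p.Letter × Bool)) :
    p.rho d (l ++ m) = p.rho d l ++ p.rho d m := by
  cases d <;> simp [rho]

theorem rho_nil (d : ℕ) : p.rho d [] = [] := by cases d <;> simp [rho]

theorem invRev_append' {L : Type*} (l m : List (L × Bool)) :
    FreeGroup.invRev (l ++ m) = FreeGroup.invRev m ++ FreeGroup.invRev l := by
  simp [FreeGroup.invRev]

theorem rho_invRev (d : ℕ) (l : List (p.Letter × Bool)) :
    p.rho d (FreeGroup.invRev l) = FreeGroup.invRev (p.rho d l) := by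
  induction d generalizing l with
  | zero => rfl
  | succ d ih =>
    induction l with
    | nil => simp [FreeGroup.invRev, rho]
    | cons a l ihl =>
      have e : a :: l = [a] ++ l := rfl
      rw [e, invRev_append', rho_append, ihl, rho_append, invRev_append']
      congr 1
      have : FreeGroup.invRev [a] = [(a.1, !a.2)] := by simp [FreeGroup.invRev]
      simp only [this, rho, List.flatMap_cons, List.flatMap_nil, List.append_nil, invRev_append',
        ih, FreeGroup.invRev_invRev, List.append_assoc]

theorem eta_append (l m : List (p.Letter × Bool)) : p.eta (l ++ m) = p.eta l ++ p.eta m := by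
  simp [eta]

theorem eta_invRev (l : List (p.Letter × Bool)) :
    p.eta (FreeGroup.invRev l) = FreeGroup.invRev (p.eta l) := by
  simp [eta, FreeGroup.invRev, Function.comp_def]

/-- The expansion given by `rho d` agrees with the next one up to degree `d`. -/
theorem expansion_agree (d : ℕ) (l : List (p.Letter × Bool)) :
    NCSeries.AgreeUpTo d (magnusPhi (p.eta (p.rho d l)))
      (magnusPhi (p.eta (p.rho (d + 1) l))) := by
  have hone : ∀ l : List (Fin n × Bool), (magnusPhi l).coeff [] = 1 := by
    intro l
    induction l with
    | nil => simp [magnusPhi, NCSeries.coeff_one]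
    | cons a l ih =>
      have e3 : magnusPhi (a :: l) = magnusPhi [a] * magnusPhi l := magnusPhi_append [a] l
      rw [e3, NCSeries.coeff_mul_nil, ih, mul_one]
      obtain ⟨h, b⟩ := a
      cases b
      · simpa [magnusPhi] using NCSeries.altGeom_nil h
      · simp [magnusPhi, NCSeries.coeff_add, NCSeries.coeff_one, NCSeries.coeff_X]
  induction d generalizing l with
  | zero =>
    intro c hc
    have : c = [] := List.length_eq_zero_iff.mp (by omega)
    rw [this, hone, hone]
  | succ d ih =>
    induction l with
    | nil => intro c _; simp [rho_nil]
    | cons a l ihl =>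
      have e : a :: l = [a] ++ l := rfl
      rw [e, rho_append, rho_append, eta_append, eta_append, magnusPhi_append, magnusPhi_append]
      refine NCSeries.AgreeUpTo.mul ?_ ihl
      have key : ∀ m : ℕ, magnusPhi (p.eta (p.rho (m + 1) [a])) =
          1 + magnusPhi (p.eta (p.rho m (FreeGroup.invRev (p.truncWord a.1)))) *
            (magnusPhi (p.eta [a]) - 1) * magnusPhi (p.eta (p.rho m (p.truncWord a.1))) := by
        intro m
        have h := magnusPhi_invRev (p.eta (p.rho m (p.truncWord a.1)))
        rw [← eta_invRev, ← rho_invRev] at h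
        simp only [rho, List.flatMap_cons, List.flatMap_nil, List.append_nil, eta_append,
          magnusPhi_append]
        rw [mul_sub, sub_mul, mul_one, h]
        abel
      rw [key, key]
      have hc := NCSeries.AgreeUpTo.conj (y := magnusPhi (p.eta [a]) - 1)
        (ih (FreeGroup.invRev (p.truncWord a.1))) (ih (p.truncWord a.1))
        (by rw [NCSeries.coeff_sub, hone, NCSeries.coeff_one]; simp)
      intro c hcl
      rw [NCSeries.coeff_add, NCSeries.coeff_add, hc c hcl]

/-- The sequence that defines `μ` is constant from the index `u` on. -/
theorem mu_eq (c : List (Fin n)) (i : Fin n) {d : ℕ} (hd : c.length ≤ d) :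
    (magnusPhi (p.eta (p.rho d (p.signedWord i)))).coeff c = p.mu c i := by
  have hc : ∀ e : ℕ, c.length ≤ e →
      (magnusPhi (p.eta (p.rho e (p.signedWord i)))).coeff c =
        (magnusPhi (p.eta (p.rho c.length (p.signedWord i)))).coeff c := by
    intro e he
    induction e, he using Nat.le_induction with
    | base => rfl
    | succ e he ih => rw [← ih, p.expansion_agree e (p.signedWord i) c he]
  have ht : Tendsto (fun e : ℕ => (magnusPhi (p.eta (p.rho e (p.signedWord i)))).coeff c) atTop
      (𝓝 ((magnusPhi (p.eta (p.rho c.length (p.signedWord i)))).coeff c)) :=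
    tendsto_const_nhds.congr' (by
      filter_upwards [eventually_ge_atTop c.length] with e he
      exact (hc e he).symm)
  rw [hc d hd, mu, ht.limUnder_eq]

end Nanophrase

/-!
For a phrase and a group with a meridian and a longitude for each component, assign to each letter
the conjugate of a meridian by a partial longitude, and ask that the values of the letters along
each component multiply to its longitude. As in Milnor's link groups, the conjugates of a meridian
commute with each other and longitudes count only modulo the normal subgroup that they generate.
Each of the moves carries solutions of these Wirtinger-type relations to solutions, up to
conjugating the meridian and the longitude of each component.

Let `M` divide all `μ` of the cyclic permutations of proper subsequences of `c₁, …, cᵤ, i`. In the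
units of the formal power series modulo `M` and modulo the monomials that are not such cyclic
permutations, the words `ρ^q` solve the relations of a phrase with meridians `1 + κ_h`: the indices
being distinct, no surviving monomial contains a variable twice, so that the units that differ from
`1` by terms containing `κ_h` form a commutative normal subgroup. Conversely, any solution is
computed by the words `ρ^q`, as the filtration by degree makes the recursion for `ρ^q` converge. A
move therefore changes the coefficient of `κ_{c₁} ⋯ κ_{cᵤ}` in the longitude of the `i`th component
by a conjugation and a substitution of conjugates for the `1 + κ_h`, neither of which is visible
modulo `M`.
-/

/-! ### Gauss codes coloured by a group -/

/-- A symbol of the Gauss code of a phrase: the bar that ends a component, or one of the two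
occurrences of a letter `D` whose occurrences lie in different components. The occurrence of
non-zero sign is `below D b`, with `b = true` for the sign `1`; the other one is `above D`. -/
inductive GaussSymbol (L : Type) : Type
  | bar
  | above (D : L)
  | below (D : L) (b : Bool)

/-- `g ^ 1` or `g ^ (-1)`; the sign is encoded as in `FreeGroup`. -/
def signPow {G : Type*} [Group G] (g : G) (b : Bool) : G := cond b g g⁻¹

section SignPow

variable {G : Type*} [Group G]

theorem signPow_not (g : G) (b : Bool) : signPow g (!b) = (signPow g b)⁻¹ := by
  cases b <;> simp [signPow]

theorem signPow_conj (x g : G) (b : Bool) : signPow (x * g * x⁻¹) b = x * signPow g b * x⁻¹ := by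
  cases b <;> simp [signPow, mul_assoc]

theorem signPow_mem {H : Subgroup G} {g : G} (h : g ∈ H) (b : Bool) : signPow g b ∈ H := by
  cases b
  · exact H.inv_mem h
  · exact h

end SignPow

namespace GaussSymbol

variable {G : Type*} {L L' : Type} [Group G]

/-- The letters of a symbol, as a list of length at most one. -/
def letters : GaussSymbol L → List L
  | bar => []
  | above D => [D]
  | below D _ => [D]

/-- Renaming of letters, used to compare codes above different alphabets. -/
def map (f : L → L') : GaussSymbol L → GaussSymbol L'
  | bar => bar
  | above D => above (f D)
  | below D b => below (f D) b

/-- The Boolean test for bars that is used to count components. -/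
def isBar : GaussSymbol L → Bool
  | bar => true
  | _ => false

/-- The number of bars of a code, by which the component index grows along it. -/
def bars (x : List (GaussSymbol L)) : ℕ := x.countP isBar

theorem bars_append (x y : List (GaussSymbol L)) : bars (x ++ y) = bars x + bars y :=
  List.countP_append

theorem bars_singleton {t : GaussSymbol L} {D : L} (ht : t.letters = [D]) : bars [t] = 0 := by
  cases t with
  | bar => cases ht
  | above | below => rfl

/-- The letter `D` does not occur in the code `x`, so that its value may be changed freely there. -/
def Absent (D : L) (x : List (GaussSymbol L)) : Prop := ∀ t ∈ x, D ∉ t.letters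

theorem absent_append {D : L} {x y : List (GaussSymbol L)} :
    Absent D (x ++ y) ↔ Absent D x ∧ Absent D y := by
  simp only [Absent, List.mem_append, or_imp, forall_and]

/-- One step in reading a code with the values `E` of its letters. The state consists of the index
of the current component and the product of the values of the signed letters met so far in it. -/
def step (E : L → G) (s : ℕ × G) : GaussSymbol L → ℕ × G
  | bar => (s.1 + 1, 1)
  | above _ => s
  | below D b => (s.1, s.2 * signPow (E D) b)

/-- The state reached by reading a code. -/
def run (E : L → G) (s : ℕ × G) (x : List (GaussSymbol L)) : ℕ × G := x.foldl (step E) s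

theorem run_append (E : L → G) (s : ℕ × G) (x y : List (GaussSymbol L)) :
    run E s (x ++ y) = run E (run E s x) y :=
  List.foldl_append

theorem run_fst (E : L → G) (s : ℕ × G) (x : List (GaussSymbol L)) :
    (run E s x).1 = s.1 + bars x := by
  induction x generalizing s with
  | nil => rfl
  | cons t x ih =>
    refine (ih (step E s t)).trans ?_
    cases t <;> simp [step, bars, isBar, List.countP_cons, add_assoc, add_comm 1]

theorem run_mul_left (E : L → G) (k : ℕ) (g h : G) {x : List (GaussSymbol L)} (hx : bars x = 0) :
    run E (k, g * h) x = (k, g * (run E (k, h) x).2) := by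
  induction x generalizing h with
  | nil => rfl
  | cons t x ih =>
    cases t with
    | bar => simp [bars, isBar] at hx
    | above D => exact ih h hx
    | below D b => simpa [run, step, mul_assoc] using ih (h * signPow (E D) b) hx

end GaussSymbol

/-- Peripheral data in a group `G` for the components of a link up to link homotopy: meridians, and
longitudes that commute with them. As in Milnor's link groups, the conjugates of a meridian
commute, so they lie in a commutative normal subgroup, and longitudes matter only modulo this
subgroup. Components are indexed by `ℕ` because a code is read through its bars. -/
structure PeripheralSystem (G : Type*) [Group G] where
  meridianSubgroup : ℕ → Subgroup G
  normal : ∀ k, (meridianSubgroup k).Normal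
  commute : ∀ k, ∀ g ∈ meridianSubgroup k, ∀ h ∈ meridianSubgroup k, Commute g h
  meridian : ℕ → G
  meridian_mem : ∀ k, meridian k ∈ meridianSubgroup k
  longitude : ℕ → G
  commute_longitude : ∀ k, Commute (meridian k) (longitude k)

namespace PeripheralSystem

open GaussSymbol

variable {G : Type*} [Group G] (P : PeripheralSystem G) {L L' : Type}

attribute [instance] PeripheralSystem.normal

/-- The condition that a symbol imposes on the values `E` when it is reached in the state `s`: an
`above` in the `k`th component carries the meridian conjugated by the partial longitude, and at the
end of the component the partial longitude is the whole one. -/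
def ColorsAt (E : L → G) (s : ℕ × G) : GaussSymbol L → Prop
  | .bar => s.2⁻¹ * P.longitude s.1 ∈ P.meridianSubgroup s.1
  | .above D => E D = s.2⁻¹ * P.meridian s.1 * s.2
  | .below _ _ => True

/-- The values `E` satisfy the Wirtinger relations at all symbols of a code read from the
state `s`. -/
def Colors (E : L → G) : ℕ × G → List (GaussSymbol L) → Prop
  | _, [] => True
  | s, t :: x => P.ColorsAt E s t ∧ Colors E (step E s t) x

/-- Two states belong to the same component and their partial longitudes agree modulo its meridian
subgroup. -/
def Congr (s s' : ℕ × G) : Prop := s.1 = s'.1 ∧ s.2⁻¹ * s'.2 ∈ P.meridianSubgroup s.1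

/-- The relation that makes local modifications of a code composable: if the values `E` satisfy
the relations of `x` in the `k`th component, then `E'` satisfies those of `x'` from every congruent
state on, and the final states are congruent again. -/
def Carries (k : ℕ) (E : L → G) (E' : L' → G) (x : List (GaussSymbol L))
    (x' : List (GaussSymbol L')) : Prop :=
  ∀ g g' : G, g⁻¹ * g' ∈ P.meridianSubgroup k → P.Colors E (k, g) x →
    P.Colors E' (k, g') x' ∧ P.Congr (run E (k, g) x) (run E' (k, g') x')

variable {P} {E E' : L → G} {k : ℕ} {s : ℕ × G} {x y : List (GaussSymbol L)} {A B D M : L}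

theorem colors_append :
    P.Colors E s (x ++ y) ↔ P.Colors E s x ∧ P.Colors E (run E s x) y := by
  induction x generalizing s with
  | nil => simp [Colors, run]
  | cons t x ih => simp [Colors, run, ih, and_assoc]

theorem colors_map (f : L' → L) {x : List (GaussSymbol L')} :
    P.Colors E s (x.map (GaussSymbol.map f)) ↔ P.Colors (E ∘ f) s x := by
  induction x generalizing s with
  | nil => rfl
  | cons t x ih => cases t <;> exact and_congr_right fun _ => ih

theorem conj_meridian_eq {g h : G} (hgh : g⁻¹ * h ∈ P.meridianSubgroup k) :
    g⁻¹ * P.meridian k * g = h⁻¹ * P.meridian k * h := by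
  have hm : g⁻¹ * P.meridian k * g ∈ P.meridianSubgroup k := by
    simpa using (P.normal k).conj_mem _ (P.meridian_mem k) g⁻¹
  calc g⁻¹ * P.meridian k * g
      = (g⁻¹ * h)⁻¹ * (g⁻¹ * P.meridian k * g * (g⁻¹ * h)) := by
        rw [(P.commute k _ hm _ hgh).eq]; group
    _ = h⁻¹ * P.meridian k * h := by group

theorem mul_right_mem {g g' : G} (h : g⁻¹ * g' ∈ P.meridianSubgroup k) (z : G) :
    (g * z)⁻¹ * (g' * z) ∈ P.meridianSubgroup k := by
  simpa [mul_assoc] using (P.normal k).conj_mem _ h z⁻¹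

theorem Colors.above_mem (h : P.Colors E s (x ++ [.above D] ++ y)) :
    E D ∈ P.meridianSubgroup (s.1 + bars x) := by
  have hD := (colors_append.1 (colors_append.1 h).1).2.1
  rw [ColorsAt, run_fst] at hD
  rw [hD]
  simpa using (P.normal _).conj_mem _ (P.meridian_mem _) (run E s x).2⁻¹

theorem Colors.above_eq_above (h : P.Colors E s (x ++ [.above A, .above B] ++ y)) : E A = E B := by
  obtain ⟨hA, hB, -⟩ := (colors_append.1 (colors_append.1 h).1).2
  exact hA.trans hB.symm

/-! ### Local modifications of codes -/

namespace Carries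

theorem append {L' : Type} {E' : L' → G} {x' y' : List (GaussSymbol L')}
    (hx : P.Carries k E E' x x') (hy : P.Carries (k + bars x) E E' y y') :
    P.Carries k E E' (x ++ y) (x' ++ y') := by
  intro g g' hg h
  obtain ⟨h₁, h₂⟩ := colors_append.1 h
  obtain ⟨hx', hfst, hsnd⟩ := hx g g' hg h₁
  have hk : (run E (k, g) x).1 = k + bars x := run_fst E _ x
  have hs : run E (k, g) x = (k + bars x, (run E (k, g) x).2) := Prod.ext hk rfl
  have hs' : run E' (k, g') x' = (k + bars x, (run E' (k, g') x').2) :=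
    Prod.ext (hfst.symm.trans hk) rfl
  rw [hs] at h₂
  rw [hk] at hsnd
  obtain ⟨hy', hc⟩ := hy _ _ hsnd h₂
  rw [colors_append, run_append, run_append, hs, hs']
  exact ⟨⟨hx', hy'⟩, hc⟩

theorem nil : P.Carries k E E' [] [] := fun _ _ hg _ => ⟨trivial, rfl, hg⟩

theorem bar : P.Carries k E E' [.bar] [.bar] := by
  refine fun g g' hg h => ⟨⟨?_, trivial⟩, rfl, by simp [run, step]⟩
  have hlam : g⁻¹ * P.longitude k ∈ P.meridianSubgroup k := h.1
  simpa [ColorsAt, mul_assoc] using mul_mem (inv_mem hg) hlam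

theorem conj {t : GaussSymbol L} (ht : t.letters = [D]) {z : G} (hz : z ∈ P.meridianSubgroup k)
    (hD : E' D = z * E D * z⁻¹) : P.Carries k E E' [t] [t] := by
  intro g g' hg h
  cases t with
  | bar => cases ht
  | above D' =>
    obtain rfl : D' = D := by simpa [letters] using ht
    have hE : E D' = g⁻¹ * P.meridian k * g := h.1
    refine ⟨⟨?_, trivial⟩, rfl, hg⟩
    calc E' D' = (g * z⁻¹)⁻¹ * P.meridian k * (g * z⁻¹) := by rw [hD, hE]; group
      _ = g'⁻¹ * P.meridian k * g' :=
        conj_meridian_eq (by simpa [mul_assoc] using mul_mem hz hg)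
  | below D' c =>
    obtain rfl : D' = D := by simpa [letters] using ht
    refine ⟨⟨trivial, trivial⟩, rfl, ?_⟩
    change (g * signPow (E D') c)⁻¹ * (g' * signPow (E' D') c) ∈ P.meridianSubgroup k
    rw [hD, signPow_conj]
    have hd : (signPow (E D') c)⁻¹ * (g⁻¹ * g' * z) * signPow (E D') c ∈ P.meridianSubgroup k := by
      simpa using (P.normal k).conj_mem _ (mul_mem hg hz) (signPow (E D') c)⁻¹
    simpa [mul_assoc] using mul_mem hd (inv_mem hz)

theorem of_agree (h : ∀ t ∈ x, ∀ D ∈ t.letters, E' D = E D) : P.Carries k E E' x x := by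
  induction x generalizing k with
  | nil => exact nil
  | cons t x ih =>
    refine append (x := [t]) (x' := [t]) ?_ (ih fun u hu => h u (List.mem_cons_of_mem _ hu))
    have hD : ∀ D ∈ t.letters, E' D = E D := h t (by simp)
    cases t with
    | bar => exact bar
    | above D => exact conj rfl (one_mem _) (by simpa using hD D (by simp [letters]))
    | below D c => exact conj rfl (one_mem _) (by simpa using hD D (by simp [letters]))

theorem above_swap (hA : E' A = E A) (hB : E' B = E B) :
    P.Carries k E E' [.above A, .above B] [.above B, .above A] := by
  intro g g' hg h
  obtain ⟨hEA, hEB, -⟩ := h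
  exact ⟨⟨hB.trans (hEB.trans (conj_meridian_eq hg)), hA.trans (hEA.trans (conj_meridian_eq hg)),
    trivial⟩, rfl, hg⟩

theorem slide_back {t : GaussSymbol L} (ht : t.letters = [D]) {b : Bool} (hM : E' M = E M)
    (hD : E' D = signPow (E M) b * E D * (signPow (E M) b)⁻¹) :
    P.Carries k E E' [.below M b, t] [t, .below M b] := by
  intro g g' hg h
  set v := signPow (E M) b with hv
  cases t with
  | bar => cases ht
  | above D' =>
    obtain rfl : D' = D := by simpa [letters] using ht
    have hE : E D' = (g * v)⁻¹ * P.meridian k * (g * v) := h.2.1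
    refine ⟨⟨?_, trivial, trivial⟩, rfl, ?_⟩
    · calc E' D' = g⁻¹ * P.meridian k * g := by rw [hD, hE]; group
        _ = g'⁻¹ * P.meridian k * g' := conj_meridian_eq hg
    · change (g * v)⁻¹ * (g' * signPow (E' M) b) ∈ P.meridianSubgroup k
      rw [hM]
      exact mul_right_mem hg v
  | below D' c =>
    obtain rfl : D' = D := by simpa [letters] using ht
    refine ⟨⟨trivial, trivial, trivial⟩, rfl, ?_⟩
    change (g * v * signPow (E D') c)⁻¹ * (g' * signPow (E' D') c * signPow (E' M) b) ∈
      P.meridianSubgroup k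
    rw [hM, hD, signPow_conj, ← hv]
    simpa [mul_assoc] using mul_right_mem hg (v * signPow (E D') c)

theorem slide_forward {t : GaussSymbol L} (ht : t.letters = [D]) {b : Bool} (hM : E' M = E M)
    (hD : E' D = signPow (E M) (!b) * E D * (signPow (E M) (!b))⁻¹) :
    P.Carries k E E' [t, .below M b] [.below M b, t] := by
  intro g g' hg h
  rw [signPow_not, inv_inv] at hD
  set v := signPow (E M) b with hv
  cases t with
  | bar => cases ht
  | above D' =>
    obtain rfl : D' = D := by simpa [letters] using ht
    have hE : E D' = g⁻¹ * P.meridian k * g := h.1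
    refine ⟨⟨trivial, ?_, trivial⟩, rfl, ?_⟩
    · change E' D' = (g' * signPow (E' M) b)⁻¹ * P.meridian k * (g' * signPow (E' M) b)
      rw [hM, ← hv, hD, hE, conj_meridian_eq hg]
      group
    · change (g * v)⁻¹ * (g' * signPow (E' M) b) ∈ P.meridianSubgroup k
      rw [hM]
      exact mul_right_mem hg v
  | below D' c =>
    obtain rfl : D' = D := by simpa [letters] using ht
    have hc : signPow (E' D') c = v⁻¹ * signPow (E D') c * v := by
      simpa [hD] using signPow_conj v⁻¹ (E D') c
    refine ⟨⟨trivial, trivial, trivial⟩, rfl, ?_⟩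
    change (g * signPow (E D') c * v)⁻¹ * (g' * signPow (E' M) b * signPow (E' D') c) ∈
      P.meridianSubgroup k
    rw [hM, hc, ← hv]
    simpa [mul_assoc] using mul_right_mem hg (signPow (E D') c * v)

theorem update [DecidableEq L] (h : Absent D x) (v : G) :
    P.Carries k E (Function.update E D v) x x :=
  of_agree fun t ht C hC => Function.update_of_ne (by rintro rfl; exact h t ht hC) _ _

theorem colors {x' : List (GaussSymbol L)} {g : G} (h : P.Carries k E E' x x')
    (hx : P.Colors E (k, g) x) : P.Colors E' (k, g) x' :=
  (h g g (by simp) hx).1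

end Carries

end PeripheralSystem

namespace PeripheralSystem

open GaussSymbol

variable {G : Type*} [Group G] {P : PeripheralSystem G} {L : Type} {E : L → G} {s : ℕ × G}
  {X Y Z T : List (GaussSymbol L)} {A B C : L}

namespace Carries

variable {k : ℕ}

theorem delete_above : P.Carries k E E [.above A, .above B] [] :=
  fun _ _ hg _ => ⟨trivial, rfl, hg⟩

theorem cancel_below (h : E A = E B) (b : Bool) :
    P.Carries k E E [.below A b, .below B (!b)] [] := by
  refine fun g g' hg _ => ⟨trivial, rfl, ?_⟩
  change (g * signPow (E A) b * signPow (E B) (!b))⁻¹ * g' ∈ P.meridianSubgroup k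
  rwa [h, signPow_not, mul_inv_cancel_right]

end Carries

namespace Colors

theorem cancel_pair {b : Bool}
    (h : P.Colors E s (X ++ [.below A b, .below B (!b)] ++ Y ++ [.above B, .above A] ++ Z)) :
    P.Colors E s (X ++ Y ++ Z) := by
  have hAB : E A = E B := (above_eq_above h).symm
  simpa using (((Carries.of_agree fun _ _ _ _ => rfl).append (Carries.cancel_below hAB b)).append
    (Carries.of_agree fun _ _ _ _ => rfl)).append Carries.delete_above |>.append
      (Carries.of_agree fun _ _ _ _ => rfl) |>.colors h

theorem cancel_pair' {b : Bool}
    (h : P.Colors E s (X ++ [.above A, .above B] ++ Y ++ [.below B (!b), .below A b] ++ Z)) :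
    P.Colors E s (X ++ Y ++ Z) := by
  have hAB : E A = E B := above_eq_above (x := X)
    (y := Y ++ [.below B (!b), .below A b] ++ Z) (by simpa using h)
  have hcancel := Carries.cancel_below (P := P) (k := s.1 + bars (X ++ [.above A, .above B] ++ Y))
    hAB.symm (!b)
  rw [Bool.not_not] at hcancel
  simpa using (((Carries.of_agree fun _ _ _ _ => rfl).append Carries.delete_above).append
    (Carries.of_agree fun _ _ _ _ => rfl)).append hcancel |>.append
      (Carries.of_agree fun _ _ _ _ => rfl) |>.colors h

open Classical in
/-- Changing the value of the single letter `D` does not affect the segments `X`, `Y`, `Z`, `T`, so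
that only the three sites have to be examined. -/
theorem update_sites {S₁ S₂ S₃ S₁' S₂' S₃' : List (GaussSymbol L)} {D : L} {v : G}
    (hD : Absent D (X ++ Y ++ Z ++ T))
    (h₁ : P.Carries (s.1 + bars X) E (Function.update E D v) S₁ S₁')
    (h₂ : P.Carries (s.1 + bars (X ++ S₁ ++ Y)) E (Function.update E D v) S₂ S₂')
    (h₃ : P.Carries (s.1 + bars (X ++ S₁ ++ Y ++ S₂ ++ Z)) E (Function.update E D v) S₃ S₃')
    (h : P.Colors E s (X ++ S₁ ++ Y ++ S₂ ++ Z ++ S₃ ++ T)) :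
    P.Colors (Function.update E D v) s (X ++ S₁' ++ Y ++ S₂' ++ Z ++ S₃' ++ T) := by
  obtain ⟨⟨⟨hX, hY⟩, hZ⟩, hT⟩ := by simpa only [absent_append] using hD
  exact ((((((Carries.update hX v).append h₁).append (.update hY v)).append h₂).append
    (.update hZ v)).append h₃).append (.update hT v) |>.colors h

section Triangle

variable {t₁ t₂ t₃ : GaussSymbol L} {b : Bool}

theorem triangle_slide_third (ht₂ : t₂.letters = [C]) (ht₃ : t₃.letters = [C])
    (hAC : A ≠ C) (hBC : B ≠ C) (hC : Absent C (X ++ Y ++ Z ++ T))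
    (h : P.Colors E s
      (X ++ [.above A, .above B] ++ Y ++ [.below A b, t₂] ++ Z ++ [.below B b, t₃] ++ T)) :
    ∃ E' : L → G, P.Colors E' s
      (X ++ [.above B, .above A] ++ Y ++ [t₂, .below A b] ++ Z ++ [t₃, .below B b] ++ T) := by
  have hAB : E A = E B := above_eq_above (x := X)
    (y := Y ++ [.below A b, t₂] ++ Z ++ [.below B b, t₃] ++ T) (by simpa using h)
  exact ⟨_, update_sites (v := signPow (E A) b * E C * (signPow (E A) b)⁻¹) hC
    (.above_swap (by simp [hAC]) (by simp [hBC])) (.slide_back ht₂ (by simp [hAC]) (by simp))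
    (.slide_back ht₃ (by simp [hBC]) (by simp [hAB])) h⟩

theorem triangle_slide_first (ht₁ : t₁.letters = [A]) (ht₂ : t₂.letters = [A])
    (hAB : A ≠ B) (hAC : A ≠ C) (hA : Absent A (X ++ Y ++ Z ++ T))
    (h : P.Colors E s
      (X ++ [t₁, .below B b] ++ Y ++ [t₂, .below C b] ++ Z ++ [.above B, .above C] ++ T)) :
    ∃ E' : L → G, P.Colors E' s
      (X ++ [.below B b, t₁] ++ Y ++ [.below C b, t₂] ++ Z ++ [.above C, .above B] ++ T) := by
  have hBC : E B = E C := above_eq_above h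
  exact ⟨_, update_sites (v := signPow (E B) (!b) * E A * (signPow (E B) (!b))⁻¹) hA
    (.slide_forward ht₁ (by simp [hAB.symm]) (by simp))
    (.slide_forward ht₂ (by simp [hAC.symm]) (by simp [hBC]))
    (.above_swap (by simp [hAB.symm]) (by simp [hAC.symm])) h⟩

theorem triangle_slide_second (ht₁ : t₁.letters = [B]) (ht₃ : t₃.letters = [B])
    (hAB : A ≠ B) (hBC : B ≠ C) (hB : Absent B (X ++ Y ++ Z ++ T))
    (h : P.Colors E s
      (X ++ [.below A b, t₁] ++ Y ++ [.above A, .above C] ++ Z ++ [t₃, .below C (!b)] ++ T)) :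
    ∃ E' : L → G, P.Colors E' s
      (X ++ [t₁, .below A b] ++ Y ++ [.above C, .above A] ++ Z ++ [.below C (!b), t₃] ++ T) := by
  have hAC : E A = E C := above_eq_above (x := X ++ [.below A b, t₁] ++ Y)
    (y := Z ++ [t₃, .below C (!b)] ++ T) (by simpa using h)
  exact ⟨_, update_sites (v := signPow (E A) b * E B * (signPow (E A) b)⁻¹) hB
    (.slide_back ht₁ (by simp [hAB]) (by simp)) (.above_swap (by simp [hAB]) (by simp [hBC.symm]))
    (.slide_forward ht₃ (by simp [hBC.symm]) (by simp [hAC])) h⟩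

end Triangle

section Swap

variable {t t' : GaussSymbol L} {b : Bool}

theorem swap_last_slide_back (ht : t.letters = [B]) (ht' : t'.letters = [B]) (hAB : A ≠ B)
    (hB : Absent B (X ++ Y ++ Z ++ T)) (hY : bars Y = 0)
    (h : P.Colors E s (X ++ [.above A] ++ Y ++ [t] ++ Z ++ [.below A b, t'] ++ T)) :
    ∃ E' : L → G, P.Colors E' s (X ++ [.above A] ++ Y ++ [t] ++ Z ++ [t', .below A b] ++ T) := by
  have hA : E A ∈ P.meridianSubgroup (s.1 + bars X) :=
    above_mem (y := Y ++ [t] ++ Z ++ [.below A b, t'] ++ T) (by simpa using h)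
  have hbars : bars (X ++ [.above A] ++ Y) = bars X := by
    rw [bars_append, bars_append, hY]; rfl
  exact ⟨_, update_sites (v := signPow (E A) b * E B * (signPow (E A) b)⁻¹) hB
    (.of_agree (by simp [letters, hAB])) (.conj ht (hbars ▸ signPow_mem hA b) (by simp))
    (.slide_back ht' (by simp [hAB]) (by simp)) h⟩

theorem swap_last_slide_forward (ht : t.letters = [A]) (ht' : t'.letters = [A]) (hAB : A ≠ B)
    (hA : Absent A (X ++ Y ++ Z ++ T)) (hY : bars Y = 0)
    (h : P.Colors E s (X ++ [t] ++ Y ++ [.above B] ++ Z ++ [t', .below B b] ++ T)) :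
    ∃ E' : L → G, P.Colors E' s (X ++ [t] ++ Y ++ [.above B] ++ Z ++ [.below B b, t'] ++ T) := by
  have hB : E B ∈ P.meridianSubgroup (s.1 + bars (X ++ [t] ++ Y)) :=
    above_mem (y := Z ++ [t', .below B b] ++ T) (by simpa using h)
  rw [bars_append, bars_append, hY, bars_singleton ht, add_zero, add_zero] at hB
  exact ⟨_, update_sites (v := signPow (E B) (!b) * E A * (signPow (E B) (!b))⁻¹) hA
    (.conj ht (signPow_mem hB (!b)) (by simp)) (.of_agree (by simp [letters, hAB.symm]))
    (.slide_forward ht' (by simp [hAB.symm]) (by simp)) h⟩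

theorem swap_first_slide_back (ht : t.letters = [B]) (ht' : t'.letters = [B]) (hAB : A ≠ B)
    (hB : Absent B (X ++ Y ++ Z ++ T)) (hZ : bars Z = 0)
    (h : P.Colors E s (X ++ [.below A b, t] ++ Y ++ [.above A] ++ Z ++ [t'] ++ T)) :
    ∃ E' : L → G, P.Colors E' s (X ++ [t, .below A b] ++ Y ++ [.above A] ++ Z ++ [t'] ++ T) := by
  have hA : E A ∈ P.meridianSubgroup (s.1 + bars (X ++ [.below A b, t] ++ Y)) :=
    above_mem (y := Z ++ [t'] ++ T) (by simpa using h)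
  have hbars : bars (X ++ [.below A b, t] ++ Y ++ [.above A] ++ Z) =
      bars (X ++ [.below A b, t] ++ Y) := by
    rw [bars_append _ Z, bars_append _ [.above A], hZ]; rfl
  exact ⟨_, update_sites (v := signPow (E A) b * E B * (signPow (E A) b)⁻¹) hB
    (.slide_back ht (by simp [hAB]) (by simp)) (.of_agree (by simp [letters, hAB]))
    (.conj ht' (hbars ▸ signPow_mem hA b) (by simp)) h⟩

theorem swap_first_slide_forward (ht : t.letters = [A]) (ht' : t'.letters = [A]) (hAB : A ≠ B)
    (hA : Absent A (X ++ Y ++ Z ++ T)) (hZ : bars Z = 0)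
    (h : P.Colors E s (X ++ [t, .below B b] ++ Y ++ [t'] ++ Z ++ [.above B] ++ T)) :
    ∃ E' : L → G, P.Colors E' s (X ++ [.below B b, t] ++ Y ++ [t'] ++ Z ++ [.above B] ++ T) := by
  have hB : E B ∈ P.meridianSubgroup (s.1 + bars (X ++ [t, .below B b] ++ Y ++ [t'] ++ Z)) :=
    above_mem (by simpa using h)
  rw [bars_append _ Z, bars_append _ [t'], hZ, bars_singleton ht', add_zero, add_zero] at hB
  exact ⟨_, update_sites (v := signPow (E B) (!b) * E A * (signPow (E B) (!b))⁻¹) hA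
    (.slide_forward ht (by simp [hAB.symm]) (by simp))
    (.conj ht' (signPow_mem hB (!b)) (by simp)) (.of_agree (by simp [letters, hAB.symm])) h⟩

theorem swap_above (h : P.Colors E s (X ++ [.above A, .above B] ++ T)) :
    P.Colors E s (X ++ [.above B, .above A] ++ T) :=
  ((Carries.of_agree fun _ _ _ _ => rfl).append (.above_swap rfl rfl)).append
    (.of_agree fun _ _ _ _ => rfl) |>.colors h

end Swap

end Colors

/-! ### Change of base point -/

/-- The system in which the peripheral elements of the `k`th component are conjugated by `u k`; it
arises when base points are moved along the components. -/
def conj (P : PeripheralSystem G) (u : ℕ → G) : PeripheralSystem G where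
  meridianSubgroup := P.meridianSubgroup
  normal := P.normal
  commute := P.commute
  meridian k := (u k)⁻¹ * P.meridian k * u k
  meridian_mem k := by simpa using (P.normal k).conj_mem _ (P.meridian_mem k) (u k)⁻¹
  longitude k := (u k)⁻¹ * P.longitude k * u k
  commute_longitude k := by
    simpa using (Commute.conj_iff (u k)⁻¹).2 (P.commute_longitude k)

theorem conj_one : P.conj 1 = P := by
  cases P
  simp [conj]

variable {k : ℕ} {x : List (GaussSymbol L)} {u : ℕ → G}

theorem colors_conj_iff {h : G} (hx : bars x = 0) :
    (P.conj u).Colors E (k, h) x ↔ P.Colors E (k, u k * h) x := by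
  induction x generalizing h with
  | nil => rfl
  | cons t x ih =>
    cases t with
    | bar => simp [bars, isBar] at hx
    | above D =>
      refine and_congr ?_ (ih hx)
      simp only [ColorsAt, conj, mul_inv_rev, mul_assoc]
    | below D b =>
      refine and_congr Iff.rfl ((ih hx).trans ?_)
      rw [← mul_assoc]
      rfl

theorem colors_conj_bar (hx : bars x = 0) (hu : u k = 1) :
    (P.conj u).Colors E (k, 1) (x ++ [.bar]) ↔ P.Colors E (k, 1) (x ++ [.bar]) := by
  rw [colors_append, colors_append, colors_conj_iff hx, hu, mul_one]
  refine and_congr Iff.rfl (and_congr ?_ Iff.rfl)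
  simp [ColorsAt, conj, run_fst, hx, hu]

/-- Moving the base point past a symbol conjugates the peripheral elements by its value. -/
theorem Colors.rotate {t : List (GaussSymbol L)}
    (ht : t = [] ∨ ∃ D, t = [.above D] ∨ ∃ b, t = [.below D b]) (hx : bars x = 0)
    (hu : u k = (run E (k, 1) t).2) (h : P.Colors E (k, 1) (t ++ x ++ [.bar])) :
    (P.conj u).Colors E (k, 1) (x ++ t ++ [.bar]) := by
  have ht₀ : bars t = 0 := by rcases ht with rfl | ⟨D, rfl | ⟨b, rfl⟩⟩ <;> rfl
  set r := (run E (k, 1) x).2 with hr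
  have hrun_t : run E (k, 1) t = (k, u k) := by
    rw [hu]; exact Prod.ext (by rw [run_fst, ht₀]; rfl) rfl
  have hrun_x : run E (k, 1) x = (k, r) := Prod.ext (by rw [run_fst, hx]; rfl) rfl
  have hrun_tx : run E (k, u k) x = (k, u k * r) := by
    simpa only [mul_one] using run_mul_left E k (u k) 1 hx
  have hrun_xt : run E (k, r) t = (k, r * u k) := by
    simpa only [mul_one, ← hu] using run_mul_left E k r 1 ht₀
  rw [colors_append, colors_append, run_append, hrun_t, hrun_tx] at h
  obtain ⟨⟨hcol_t, hcol_x⟩, hbar, -⟩ := h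
  have hlam : (u k * r)⁻¹ * P.longitude k ∈ P.meridianSubgroup k := hbar
  rw [colors_append, colors_append, run_append, hrun_x, hrun_xt, colors_conj_iff hx, mul_one]
  refine ⟨⟨hcol_x, ?_⟩, ?_, trivial⟩
  · rcases ht with rfl | ⟨D, rfl | ⟨b, rfl⟩⟩
    · trivial
    · refine ⟨?_, trivial⟩
      have hu₁ : u k = 1 := hu
      have hD : E D = P.meridian k := by simpa [Colors, ColorsAt] using hcol_t
      rw [hu₁, one_mul] at hlam
      simpa [ColorsAt, conj, hu₁, hD, conj_meridian_eq hlam] using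
        (P.commute_longitude k).symm.inv_mul_cancel.symm
    · exact ⟨trivial, trivial⟩
  · change (r * u k)⁻¹ * ((u k)⁻¹ * P.longitude k * u k) ∈ P.meridianSubgroup k
    simpa [mul_assoc] using (P.normal k).conj_mem _ hlam (u k)⁻¹

end PeripheralSystem

/-! ### The Gauss code of a nanophrase -/

/-- Whether the first occurrence of a letter with the given projection is the one of non-zero sign,
provided that the two occurrences lie in different components. -/
def AlphaV.signedFirst : AlphaV → Bool
  | bPlus | aMinus => true
  | aPlus | bMinus => false

/-- Whether the non-zero sign of a letter with the given projection is `1`. -/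
def AlphaV.positive : AlphaV → Bool
  | aPlus | bPlus => true
  | aMinus | bMinus => false

theorem AlphaV.signedFirst_tau (a : AlphaV) : a.tau.signedFirst = a.signedFirst := by
  cases a <;> rfl

theorem AlphaV.positive_tau (a : AlphaV) : a.tau.positive = !a.positive := by
  cases a <;> rfl

/-- The triples of `S_v` are those for which one of the three strands of a third Reidemeister move
lies below or above the other two, or is the middle one between them. -/
theorem AlphaV.slide_of_mem_S {a b c : AlphaV} (h : (a, b, c) ∈ AlphaV.S) :
    (a.signedFirst = false ∧ b.signedFirst = false ∧ a.positive = b.positive) ∨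
      (b.signedFirst = true ∧ c.signedFirst = true ∧ b.positive = c.positive) ∨
      (a.signedFirst = true ∧ c.signedFirst = false ∧ c.positive = !a.positive) := by
  simp only [AlphaV.S, Set.mem_insert_iff, Set.mem_singleton_iff, Prod.mk.injEq] at h
  rcases h with h | h | h | h | h | h | h | h | h | h | h | h <;> obtain ⟨rfl, rfl, rfl⟩ := h <;>
    simp [AlphaV.positive, AlphaV.signedFirst]

/-- The components of the two occurrences of a letter, in the order of the phrase, and its
projection. Components are natural numbers because segments of a phrase are read starting from an
arbitrary component. -/
structure CrossingData where
  first : ℕ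
  second : ℕ
  proj : AlphaV

namespace GaussSymbol

variable {L : Type}

/-- The symbol of the first occurrence of a letter whose occurrences lie in different
components. -/
def ofFirst (a : AlphaV) (D : L) : GaussSymbol L :=
  if a.signedFirst then below D a.positive else above D

/-- The symbol of the second occurrence of a letter whose occurrences lie in different
components. -/
def ofSecond (a : AlphaV) (D : L) : GaussSymbol L :=
  if a.signedFirst then above D else below D a.positive

theorem ofFirst_eq_below {a : AlphaV} (h : a.signedFirst = true) (D : L) :
    ofFirst a D = below D a.positive := by
  rw [ofFirst, if_pos h]

theorem ofFirst_eq_above {a : AlphaV} (h : a.signedFirst = false) (D : L) :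
    ofFirst a D = above D := by
  simp [ofFirst, h]

theorem ofSecond_eq_above {a : AlphaV} (h : a.signedFirst = true) (D : L) :
    ofSecond a D = above D := by
  rw [ofSecond, if_pos h]

theorem ofSecond_eq_below {a : AlphaV} (h : a.signedFirst = false) (D : L) :
    ofSecond a D = below D a.positive := by
  simp [ofSecond, h]

theorem letters_ofFirst (a : AlphaV) (D : L) : (ofFirst a D).letters = [D] := by
  unfold ofFirst; split_ifs <;> rfl

theorem letters_ofSecond (a : AlphaV) (D : L) : (ofSecond a D).letters = [D] := by
  unfold ofSecond; split_ifs <;> rfl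

end GaussSymbol

section Symbols

open GaussSymbol

variable {L L' : Type}

/-- The code of an occurrence of the letter `D` in the `k`th component; it is empty if both
occurrences of `D` lie in one component. -/
def symbolsAt (d : L → CrossingData) (k : ℕ) (D : L) : List (GaussSymbol L) :=
  if (d D).first = (d D).second then []
  else if k = (d D).first then [ofFirst (d D).proj D]
  else if k = (d D).second then [ofSecond (d D).proj D]
  else []

/-- The Gauss code of a segment of a phrase that starts in the `k`th component. -/
def symbols (d : L → CrossingData) : ℕ → List (Option L) → List (GaussSymbol L)
  | _, [] => []
  | k, none :: x => .bar :: symbols d (k + 1) x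
  | k, some D :: x => symbolsAt d k D ++ symbols d k x

/-- The number of bars of a segment of a phrase. -/
def phraseBars (x : List (Option L)) : ℕ := x.countP Option.isNone

/-- The letter `D` occurs in the `i`th component of a segment that starts in the `k`th one. -/
def OccursAt : ℕ → List (Option L) → ℕ → L → Prop
  | _, [], _, _ => False
  | k, none :: x, i, D => OccursAt (k + 1) x i D
  | k, some C :: x, i, D => (i = k ∧ D = C) ∨ OccursAt k x i D

variable {d : L → CrossingData} {k i : ℕ} {x y : List (Option L)} {D : L}

@[simp]
theorem phraseBars_append (x y : List (Option L)) :
    phraseBars (x ++ y) = phraseBars x + phraseBars y :=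
  List.countP_append

@[simp]
theorem phraseBars_map_some (v : List L) : phraseBars (v.map some) = 0 := by
  simp [phraseBars]

theorem symbols_append (d : L → CrossingData) (k : ℕ) (x y : List (Option L)) :
    symbols d k (x ++ y) = symbols d k x ++ symbols d (k + phraseBars x) y := by
  induction x generalizing k with
  | nil => rfl
  | cons t x ih =>
    cases t <;> simp [symbols, phraseBars, ih, add_assoc, add_comm 1]

theorem occursAt_append :
    OccursAt k (x ++ y) i D ↔ OccursAt k x i D ∨ OccursAt (k + phraseBars x) y i D := by
  induction x generalizing k with
  | nil => simp [OccursAt, phraseBars]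
  | cons t x ih =>
    cases t <;> simp [OccursAt, phraseBars, ih, or_assoc, add_assoc, add_comm 1]

theorem OccursAt.mem (h : OccursAt k x i D) : some D ∈ x := by
  induction x generalizing k with
  | nil => exact h.elim
  | cons t x ih =>
    cases t with
    | none => exact List.mem_cons_of_mem _ (ih h)
    | some C =>
      rcases h with h | h
      · simp [h.2]
      · exact List.mem_cons_of_mem _ (ih h)

theorem occursAt_map {f : L' → L} (hf : Function.Injective f) {x : List (Option L')} {D : L'} :
    OccursAt k (x.map (Option.map f)) i (f D) ↔ OccursAt k x i D := by
  induction x generalizing k with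
  | nil => rfl
  | cons t x ih => cases t <;> simp [OccursAt, ih, hf.eq_iff]

theorem occursAt_map_some (v : List L) : OccursAt k (v.map some) i D ↔ i = k ∧ D ∈ v := by
  induction v with
  | nil => simp [OccursAt]
  | cons C v ih => simp only [List.map_cons, OccursAt, ih, List.mem_cons]; tauto

theorem symbolsAt_eq (d : L → CrossingData) (k : ℕ) (D : L) :
    symbolsAt d k D = [] ∨ symbolsAt d k D = [.above D] ∨ ∃ b, symbolsAt d k D = [.below D b] := by
  unfold symbolsAt ofFirst ofSecond
  split_ifs <;> simp

theorem bars_symbols (d : L → CrossingData) (k : ℕ) (x : List (Option L)) :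
    bars (symbols d k x) = phraseBars x := by
  induction x generalizing k with
  | nil => rfl
  | cons t x ih =>
    cases t with
    | none => simpa [symbols, bars, phraseBars, isBar, List.countP_cons] using ih (k + 1)
    | some D =>
      rw [symbols, bars_append, ih]
      rcases symbolsAt_eq d k D with h | h | ⟨b, h⟩ <;> simp [h, bars, isBar, phraseBars]

theorem absent_symbols (d : L → CrossingData) (k : ℕ) (h : some D ∉ x) :
    Absent D (symbols d k x) := by
  induction x generalizing k with
  | nil => simp [Absent, symbols]
  | cons t x ih =>
    rw [List.mem_cons, not_or] at h
    cases t with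
    | none => simpa [symbols, Absent, letters] using ih (k + 1) h.2
    | some C =>
      refine absent_append.2 ⟨?_, ih k h.2⟩
      have hDC : D ≠ C := fun hDC => h.1 (by rw [hDC])
      rcases symbolsAt_eq d k C with h | h | ⟨b, h⟩ <;> simp [h, Absent, letters, hDC]

theorem symbols_map (f : L' → L) {d' : L' → CrossingData} (hd : ∀ D, d' D = d (f D)) (k : ℕ)
    (x : List (Option L')) :
    symbols d k (x.map (Option.map f)) = (symbols d' k x).map (GaussSymbol.map f) := by
  induction x generalizing k with
  | nil => rfl
  | cons t x ih =>
    cases t with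
    | none => simp [symbols, GaussSymbol.map, ih]
    | some D =>
      rw [symbols, List.map_append, ← ih, List.map_cons, Option.map_some, symbols]
      congr 1
      unfold symbolsAt ofFirst ofSecond
      rw [hd]
      split_ifs <;> rfl

theorem symbols_congr {d d' : L → CrossingData} (h : ∀ i D, symbolsAt d' i D = symbolsAt d i D)
    (k : ℕ) (x : List (Option L)) : symbols d' k x = symbols d k x := by
  induction x generalizing k with
  | nil => rfl
  | cons t x ih => cases t <;> simp [symbols, ih, h]

theorem occursAt_flatMap (ws : List (List L)) :
    OccursAt k (ws.flatMap fun v => v.map some ++ [none]) i D ↔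
      ∃ j, ∃ h : j < ws.length, i = k + j ∧ D ∈ ws[j] := by
  induction ws generalizing k with
  | nil => simp [OccursAt]
  | cons v ws ih =>
    have hbars : phraseBars (v.map some ++ [none]) = 1 := by simp [phraseBars]
    rw [List.flatMap_cons, occursAt_append, occursAt_append, occursAt_map_some, hbars, ih,
      ← Nat.or_exists_add_one
        (p := fun j => ∃ h : j < (v :: ws).length, i = k + j ∧ D ∈ (v :: ws)[j])]
    simp [OccursAt, add_assoc, add_comm 1]

theorem occursAt_flatPhrase {n : ℕ} (w : Fin n → List L) :
    OccursAt 0 (flatPhrase w) i D ↔ ∃ j : Fin n, i = j ∧ D ∈ w j := by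
  simp [flatPhrase, occursAt_flatMap, Fin.exists_iff]

theorem flatPhrase_map {n : ℕ} (f : L' → L) (w : Fin n → List L') :
    flatPhrase (fun j => (w j).map f) = (flatPhrase w).map (Option.map f) := by
  have hofFn : List.ofFn (fun j => (w j).map f) = (List.ofFn w).map (List.map f) :=
    List.map_ofFn.symm
  rw [flatPhrase, hofFn, List.flatMap_map, flatPhrase, List.map_flatMap]
  simp [Function.comp_def]

theorem count_flatPhrase [DecidableEq L] {n : ℕ} (w : Fin n → List L) (A : L) :
    (flatPhrase w).count (some A) = (List.ofFn w).flatten.count A := by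
  have hcount (v : List L) : (v.map some ++ [none]).count (some A) = v.count A := by
    simp [List.count_map_of_injective _ _ (Option.some_injective L)]
  simp [flatPhrase, List.count_flatMap, List.count_flatten, Function.comp_def, hcount]

end Symbols

namespace PeripheralSystem

variable {G : Type*} [Group G] {P : PeripheralSystem G} {L : Type} {E : L → G}

theorem colors_flatMap (d : L → CrossingData) (k : ℕ) (ws : List (List L)) :
    P.Colors E (k, 1) (symbols d k (ws.flatMap fun v => v.map some ++ [none])) ↔
      ∀ j, ∀ h : j < ws.length,
        P.Colors E (k + j, 1) (symbols d (k + j) (ws[j].map some) ++ [.bar]) := by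
  induction ws generalizing k with
  | nil => simp [Colors, symbols]
  | cons v ws ih =>
    have hsym : symbols d k (v.map some ++ [none]) = symbols d k (v.map some) ++ [.bar] := by
      rw [symbols_append]; rfl
    have hrun : GaussSymbol.run E (k, (1 : G)) (symbols d k (v.map some) ++ [.bar]) =
        (k + 1, 1) := by
      rw [GaussSymbol.run_append]
      refine Prod.ext ?_ rfl
      change (GaussSymbol.run E _ _).1 + 1 = _
      rw [GaussSymbol.run_fst, bars_symbols, phraseBars_map_some]
    have hbars : phraseBars (v.map some ++ [none]) = 1 := by simp [phraseBars]
    rw [List.flatMap_cons, symbols_append, hbars, hsym, colors_append, hrun, ih]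
    refine ⟨fun ⟨h, hs⟩ j hj => ?_, fun h => ⟨h 0 (by simp), fun j hj => ?_⟩⟩
    · cases j with
      | zero => exact h
      | succ j => simpa [add_assoc, add_comm 1] using hs j (by simpa using hj)
    · rw [add_assoc, add_comm 1]
      exact h (j + 1) (by simpa using hj)

end PeripheralSystem

theorem IsGaussPhrase.notMem {L : Type} {n : ℕ} {w : Fin n → List L} (hw : IsGaussPhrase w)
    {A : L} {x y z : List (Option L)} (h : flatPhrase w = x ++ [some A] ++ y ++ [some A] ++ z) :
    some A ∉ x ∧ some A ∉ y ∧ some A ∉ z := by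
  classical
  have hcount : (flatPhrase w).count (some A) = 2 := by
    rw [count_flatPhrase]; convert hw A
  simp only [h, List.count_append, List.count_singleton_self] at hcount
  simp only [← List.count_eq_zero]
  omega

namespace Nanophrase

variable {n : ℕ} {p q : Nanophrase AlphaV n}

/-- The position of a letter and its projection. -/
noncomputable def crossingData (p : Nanophrase AlphaV n) (D : p.Letter) : CrossingData :=
  ⟨p.firstComp D, p.secondComp D, p.proj D⟩

theorem mem_comps {D : p.Letter} {i : Fin n} : i ∈ p.comps D ↔ D ∈ p.word i := by
  simp [comps]

theorem crossingData_congr {D : p.Letter} {D' : q.Letter} (hproj : p.proj D = q.proj D')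
    (h : ∀ i, OccursAt 0 (flatPhrase p.word) i D ↔ OccursAt 0 (flatPhrase q.word) i D') :
    p.crossingData D = q.crossingData D' := by
  have hcomps : p.comps D = q.comps D' := by
    ext i
    simpa [mem_comps, occursAt_flatPhrase, Fin.val_inj] using h i
  simp only [crossingData, firstComp, secondComp, hcomps, hproj]

theorem crossingData_eq {A : p.Letter} {x y z : List (Option p.Letter)}
    (h : flatPhrase p.word = x ++ [some A] ++ y ++ [some A] ++ z) :
    p.crossingData A = ⟨phraseBars x, phraseBars x + phraseBars y, p.proj A⟩ := by
  obtain ⟨hx, hy, hz⟩ := p.gauss.notMem h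
  have hocc (i : ℕ) : OccursAt 0 (flatPhrase p.word) i A ↔
      i = phraseBars x ∨ i = phraseBars x + phraseBars y := by
    have hx' : ¬ OccursAt 0 x i A := fun h => hx h.mem
    have hy' (k) : ¬ OccursAt k y i A := fun h => hy h.mem
    have hz' (k) : ¬ OccursAt k z i A := fun h => hz h.mem
    rw [h]
    simp [occursAt_append, OccursAt, hx', hy', hz', phraseBars]
  have hmem (i : Fin n) : i ∈ p.comps A ↔
      (i : ℕ) = phraseBars x ∨ (i : ℕ) = phraseBars x + phraseBars y := by
    rw [← hocc, mem_comps, occursAt_flatPhrase]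
    simp [Fin.val_inj]
  obtain ⟨i₁, hi₁, -⟩ := (occursAt_flatPhrase _).1 ((hocc _).2 (Or.inl rfl))
  obtain ⟨i₂, hi₂, -⟩ := (occursAt_flatPhrase _).1 ((hocc _).2 (Or.inr rfl))
  have hfirst : p.firstComp A = i₁ :=
    le_antisymm (Finset.min'_le _ _ ((hmem _).2 (Or.inl hi₁.symm)))
      (Finset.le_min' _ _ _ fun i hi => by have := (hmem i).1 hi; omega)
  have hsecond : p.secondComp A = i₂ :=
    le_antisymm (Finset.max'_le _ _ _ fun i hi => by have := (hmem i).1 hi; omega)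
      (Finset.le_max' _ _ ((hmem _).2 (Or.inr hi₂.symm)))
  rw [crossingData, hfirst, hsecond, hi₂, hi₁]

/-- The values `E` of the letters satisfy the Wirtinger relations of the phrase. -/
def Solves {G : Type*} [Group G] (p : Nanophrase AlphaV n) (P : PeripheralSystem G)
    (E : p.Letter → G) : Prop :=
  P.Colors E (0, 1) (symbols p.crossingData 0 (flatPhrase p.word))

variable {G : Type*} [Group G] {P : PeripheralSystem G}

theorem solves_iff {E : p.Letter → G} :
    p.Solves P E ↔ ∀ i : Fin n,
      P.Colors E (i, 1) (symbols p.crossingData i ((p.word i).map some) ++ [.bar]) := by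
  simp [Solves, flatPhrase, PeripheralSystem.colors_flatMap, Fin.forall_iff]

end Nanophrase

/-! ### Invariance of solutions under the moves -/

namespace PeripheralSystem

open GaussSymbol

variable {G : Type*} [Group G] {P : PeripheralSystem G} {L : Type} {E : L → G}
  {d : L → CrossingData} {x y z t : List (Option L)} {A B C : L} {a b c : AlphaV}

namespace Colors

theorem remove_loop (hA : d A = ⟨phraseBars x, phraseBars x, a⟩)
    (h : P.Colors E (0, 1) (symbols d 0 (x ++ [some A, some A] ++ y))) :
    P.Colors E (0, 1) (symbols d 0 (x ++ y)) := by
  simpa [symbols_append, symbols, symbolsAt, hA, phraseBars] using h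

theorem remove_bigon (hab : a.tau = b)
    (hA : d A = ⟨phraseBars x, phraseBars x + phraseBars y, a⟩)
    (hB : d B = ⟨phraseBars x, phraseBars x + phraseBars y, b⟩)
    (h : P.Colors E (0, 1)
      (symbols d 0 (x ++ [some A, some B] ++ y ++ [some B, some A] ++ z))) :
    P.Colors E (0, 1) (symbols d 0 (x ++ y ++ z)) := by
  have hbars (D D' : L) : phraseBars [some D, some D'] = 0 := rfl
  simp only [symbols_append, symbols, phraseBars_append, hbars, add_zero, zero_add,
    List.append_nil] at h ⊢
  by_cases hy : phraseBars y = 0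
  · simpa [symbolsAt, hA, hB, hy] using h
  · subst hab
    cases ha : a.signedFirst
    · refine cancel_pair' (A := A) (B := B) (b := a.positive) ?_
      simpa [symbolsAt, hA, hB, hy, ofFirst, ofSecond, ha, AlphaV.signedFirst_tau,
        AlphaV.positive_tau] using h
    · refine cancel_pair (A := A) (B := B) (b := a.positive) ?_
      simpa [symbolsAt, hA, hB, hy, ofFirst, ofSecond, ha, AlphaV.signedFirst_tau,
        AlphaV.positive_tau] using h

section Triangle

variable {s : ℕ × G} {X Y Z T : List (GaussSymbol L)}

theorem triangle_of_mem_S (hS : (a, b, c) ∈ AlphaV.S) (hAB : A ≠ B) (hAC : A ≠ C) (hBC : B ≠ C)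
    (hA : Absent A (X ++ Y ++ Z ++ T)) (hB : Absent B (X ++ Y ++ Z ++ T))
    (hC : Absent C (X ++ Y ++ Z ++ T))
    (h : P.Colors E s (X ++ [ofFirst a A, ofFirst b B] ++ Y ++ [ofSecond a A, ofFirst c C] ++
      Z ++ [ofSecond b B, ofSecond c C] ++ T)) :
    ∃ E' : L → G, P.Colors E' s (X ++ [ofFirst b B, ofFirst a A] ++ Y ++
      [ofFirst c C, ofSecond a A] ++ Z ++ [ofSecond c C, ofSecond b B] ++ T) := by
  rcases AlphaV.slide_of_mem_S hS with ⟨ha, hb, hab⟩ | ⟨hb, hc, hbc⟩ | ⟨ha, hc, hac⟩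
  · rw [ofFirst_eq_above ha, ofFirst_eq_above hb, ofSecond_eq_below ha, ofSecond_eq_below hb,
      hab] at h ⊢
    exact triangle_slide_third (letters_ofFirst c C) (letters_ofSecond c C) hAC hBC hC h
  · rw [ofFirst_eq_below hb, ofFirst_eq_below hc, ofSecond_eq_above hb, ofSecond_eq_above hc,
      hbc] at h ⊢
    exact triangle_slide_first (letters_ofFirst a A) (letters_ofSecond a A) hAB hAC hA h
  · rw [ofFirst_eq_below ha, ofFirst_eq_above hc, ofSecond_eq_above ha, ofSecond_eq_below hc,
      hac] at h ⊢
    exact triangle_slide_second (letters_ofFirst b B) (letters_ofSecond b B) hAB hBC hB h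

theorem swap_last (hBC : B ≠ C) (hB : Absent B (X ++ Y ++ Z ++ T))
    (hC : Absent C (X ++ Y ++ Z ++ T)) (hY : bars Y = 0)
    (h : P.Colors E s (X ++ [ofFirst b B] ++ Y ++ [ofFirst c C] ++ Z ++
      [ofSecond b B, ofSecond c C] ++ T)) :
    ∃ E' : L → G, P.Colors E' s (X ++ [ofFirst b B] ++ Y ++ [ofFirst c C] ++ Z ++
      [ofSecond c C, ofSecond b B] ++ T) := by
  cases hb : b.signedFirst
  · rw [ofFirst_eq_above hb, ofSecond_eq_below hb] at *
    exact swap_last_slide_back (letters_ofFirst c C) (letters_ofSecond c C) hBC hC hY h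
  · cases hc : c.signedFirst
    · rw [ofFirst_eq_above hc, ofSecond_eq_below hc] at *
      exact swap_last_slide_forward (letters_ofFirst b B) (letters_ofSecond b B) hBC hB hY h
    · rw [ofSecond_eq_above hb, ofSecond_eq_above hc] at *
      exact ⟨E, swap_above h⟩

theorem swap_first (hAB : A ≠ B) (hA : Absent A (X ++ Y ++ Z ++ T))
    (hB : Absent B (X ++ Y ++ Z ++ T)) (hZ : bars Z = 0)
    (h : P.Colors E s (X ++ [ofFirst a A, ofFirst b B] ++ Y ++ [ofSecond a A] ++ Z ++
      [ofSecond b B] ++ T)) :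
    ∃ E' : L → G, P.Colors E' s (X ++ [ofFirst b B, ofFirst a A] ++ Y ++ [ofSecond a A] ++ Z ++
      [ofSecond b B] ++ T) := by
  cases ha : a.signedFirst
  · cases hb : b.signedFirst
    · rw [ofFirst_eq_above ha, ofFirst_eq_above hb] at *
      refine ⟨E, ?_⟩
      simpa using swap_above (X := X) (T := Y ++ [ofSecond a A] ++ Z ++ [ofSecond b B] ++ T)
        (by simpa using h)
    · rw [ofFirst_eq_below hb, ofSecond_eq_above hb] at *
      exact swap_first_slide_forward (letters_ofFirst a A) (letters_ofSecond a A) hAB hA hZ h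
  · rw [ofFirst_eq_below ha, ofSecond_eq_above ha] at *
    exact swap_first_slide_back (letters_ofFirst b B) (letters_ofSecond b B) hAB hB hZ h

end Triangle

theorem move_triangle {i j k : ℕ} (hi : i = phraseBars x) (hj : j = i + phraseBars y)
    (hk : k = j + phraseBars z) (hS : (a, b, c) ∈ AlphaV.S)
    (hAB : A ≠ B) (hAC : A ≠ C) (hBC : B ≠ C)
    (hA : some A ∉ x ++ y ++ z ++ t) (hB : some B ∉ x ++ y ++ z ++ t)
    (hC : some C ∉ x ++ y ++ z ++ t)
    (hdA : d A = ⟨i, j, a⟩) (hdB : d B = ⟨i, k, b⟩) (hdC : d C = ⟨j, k, c⟩)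
    (h : P.Colors E (0, 1) (symbols d 0
      (x ++ [some A, some B] ++ y ++ [some A, some C] ++ z ++ [some B, some C] ++ t))) :
    ∃ E' : L → G, P.Colors E' (0, 1) (symbols d 0
      (x ++ [some B, some A] ++ y ++ [some C, some A] ++ z ++ [some C, some B] ++ t)) := by
  have hbars (D D' : L) : phraseBars [some D, some D'] = 0 := rfl
  have absent {D : L} (hD : some D ∉ x ++ y ++ z ++ t) : Absent D (symbols d 0 x ++
      symbols d i y ++ symbols d j z ++ symbols d k t) := by
    simp only [List.mem_append, not_or] at hD
    simp only [absent_append, absent_symbols _ _ hD.1.1.1, absent_symbols _ _ hD.1.1.2,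
      absent_symbols _ _ hD.1.2, absent_symbols _ _ hD.2, and_self]
  simp only [symbols_append, symbols, phraseBars_append, hbars, add_zero, zero_add,
    List.append_nil, ← hi, ← hj, ← hk] at h ⊢
  by_cases hij : i = j <;> by_cases hjk : j = k
  · exact ⟨E, by simpa [symbolsAt, hdA, hdB, hdC, ← hjk, ← hij] using h⟩
  · have hY : bars (symbols d i y) = 0 := by rw [bars_symbols]; omega
    have := swap_last (b := b) (c := c) (T := symbols d k t) (Z := symbols d j z) hBC (absent hB)
      (absent hC) hY (by simpa [symbolsAt, hdA, hdB, hdC, hij, hjk, Ne.symm hjk] using h)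
    simpa [symbolsAt, hdA, hdB, hdC, hij, hjk, Ne.symm hjk] using this
  · have hZ : bars (symbols d j z) = 0 := by rw [bars_symbols]; omega
    have hik : i ≠ k := by omega
    have := swap_first (a := a) (b := b) (T := symbols d k t) (Y := symbols d i y) hAB (absent hA)
      (absent hB) hZ (by simpa [symbolsAt, hdA, hdB, hdC, hik, hjk, Ne.symm hik] using h)
    simpa [symbolsAt, hdA, hdB, hdC, hik, hjk, Ne.symm hik] using this
  · have hik : i ≠ k := by omega
    have := triangle_of_mem_S hS hAB hAC hBC (absent hA) (absent hB) (absent hC)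
      (by simpa [symbolsAt, hdA, hdB, hdC, hij, hjk, hik, Ne.symm hij, Ne.symm hjk,
        Ne.symm hik] using h)
    simpa [symbolsAt, hdA, hdB, hdC, hij, hjk, hik, Ne.symm hij, Ne.symm hjk, Ne.symm hik]
      using this

end Colors
end PeripheralSystem

open Classical in
theorem IsGaussPhrase.sum_count {L : Type} {n : ℕ} {w : Fin n → List L} (hw : IsGaussPhrase w)
    (A : L) : ∑ i, (w i).count A = 2 := by
  rw [← List.sum_ofFn, ← hw A, List.count_flatten, List.map_ofFn]
  rfl

theorem IsGaussPhrase.eq_of_mem {L : Type} {n : ℕ} {w : Fin n → List L} (hw : IsGaussPhrase w)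
    {A : L} {i j : Fin n} {x y z : List L} (h : w i = x ++ [A] ++ y ++ [A] ++ z)
    (hj : A ∈ w j) : j = i := by
  classical
  by_contra hji
  have htwo : 2 ≤ (w i).count A := by
    simp only [h, List.count_append, List.count_singleton_self]
    omega
  have hle : (w i).count A + (w j).count A ≤ 2 := by
    rw [← hw.sum_count A, ← Finset.sum_pair (f := fun j => (w j).count A) (Ne.symm hji)]
    exact Finset.sum_le_sum_of_subset (Finset.subset_univ _)
  have := List.count_pos_iff.2 hj
  omega

namespace Nanophrase

open GaussSymbol PeripheralSystem

variable {G : Type*} [Group G] {P : PeripheralSystem G} {n : ℕ} {p q : Nanophrase AlphaV n}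
  {E : p.Letter → G}

theorem Solves.of_map (f : q.Letter → p.Letter) (hf : Function.Injective f)
    (hproj : ∀ D, q.proj D = p.proj (f D))
    (hocc : ∀ D i, OccursAt 0 ((flatPhrase q.word).map (Option.map f)) i (f D) ↔
      OccursAt 0 (flatPhrase p.word) i (f D))
    (h : P.Colors E (0, 1) (symbols p.crossingData 0 ((flatPhrase q.word).map (Option.map f)))) :
    q.Solves P (E ∘ f) := by
  have hdata (D : q.Letter) : q.crossingData D = p.crossingData (f D) :=
    crossingData_congr (hproj D) fun i => (occursAt_map hf).symm.trans (hocc D i)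
  rwa [symbols_map f hdata, colors_map] at h

theorem Solves.iso (f : p.Letter ≃ q.Letter) (hproj : ∀ A, q.proj (f A) = p.proj A)
    (hword : ∀ i, q.word i = (p.word i).map f) (h : p.Solves P E) :
    q.Solves P (E ∘ f.symm) := by
  have hphrase : (flatPhrase q.word).map (Option.map f.symm) = flatPhrase p.word := by
    rw [← flatPhrase_map]
    simp [hword]
  refine .of_map f.symm f.symm.injective (fun D => ?_) (fun D i => ?_) ?_
  · rw [← hproj, f.apply_symm_apply]
  · rw [hphrase]
  · rwa [hphrase]

theorem Solves.h1 {A : p.Letter} (f : q.Letter → p.Letter) (hf : Function.Injective f)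
    (hproj : ∀ D, q.proj D = p.proj (f D)) (hA : ∀ D, f D ≠ A) {x y : List (Option p.Letter)}
    (hp : flatPhrase p.word = x ++ [some A, some A] ++ y)
    (hq : (flatPhrase q.word).map (Option.map f) = x ++ y) (h : p.Solves P E) :
    q.Solves P (E ∘ f) := by
  have hdata := crossingData_eq (A := A) (x := x) (y := []) (z := y) (by simp [hp])
  refine .of_map f hf hproj (fun D i => ?_) ?_
  · simp [hp, hq, occursAt_append, OccursAt, phraseBars, hA D]
  · rw [Solves, hp] at h
    rw [hq]
    exact Colors.remove_loop hdata h

theorem Solves.h2 {A B : p.Letter} (f : q.Letter → p.Letter) (hf : Function.Injective f)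
    (hproj : ∀ D, q.proj D = p.proj (f D)) (hA : ∀ D, f D ≠ A) (hB : ∀ D, f D ≠ B)
    (hAB : (p.proj A).tau = p.proj B) {x y z : List (Option p.Letter)}
    (hp : flatPhrase p.word = x ++ [some A, some B] ++ y ++ [some B, some A] ++ z)
    (hq : (flatPhrase q.word).map (Option.map f) = x ++ y ++ z) (h : p.Solves P E) :
    q.Solves P (E ∘ f) := by
  have hdataA := crossingData_eq (A := A) (x := x) (y := [some B] ++ y ++ [some B]) (z := z)
    (by simp [hp])
  have hdataB := crossingData_eq (A := B) (x := x ++ [some A]) (y := y) (z := [some A] ++ z)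
    (by simp [hp])
  refine .of_map f hf hproj (fun D i => ?_) ?_
  · simp [hp, hq, occursAt_append, OccursAt, phraseBars, hA D, hB D]
  · rw [Solves, hp] at h
    rw [hq]
    exact Colors.remove_bigon hAB (by simpa [phraseBars] using hdataA)
      (by simpa [phraseBars] using hdataB) h

theorem Solves.h3 {A B C : p.Letter} (f : q.Letter → p.Letter) (hf : Function.Injective f)
    (hproj : ∀ D, q.proj D = p.proj (f D)) (hS : (p.proj A, p.proj B, p.proj C) ∈ AlphaV.S)
    {x y z t : List (Option p.Letter)}
    (hp : flatPhrase p.word =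
      x ++ [some A, some B] ++ y ++ [some A, some C] ++ z ++ [some B, some C] ++ t)
    (hq : (flatPhrase q.word).map (Option.map f) =
      x ++ [some B, some A] ++ y ++ [some C, some A] ++ z ++ [some C, some B] ++ t)
    (h : p.Solves P E) : ∃ E', q.Solves P E' := by
  have hpA : flatPhrase p.word = x ++ [some A] ++ ([some B] ++ y) ++ [some A] ++
      ([some C] ++ z ++ [some B, some C] ++ t) := by simp [hp]
  have hpB : flatPhrase p.word = x ++ [some A] ++ [some B] ++ (y ++ [some A, some C] ++ z) ++
      [some B] ++ ([some C] ++ t) := by simp [hp]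
  have hpC : flatPhrase p.word = x ++ [some A, some B] ++ y ++ [some A] ++ [some C] ++
      (z ++ [some B]) ++ [some C] ++ t := by simp [hp]
  have hA := p.gauss.notMem hpA
  have hB := p.gauss.notMem hpB
  have hC := p.gauss.notMem hpC
  simp only [List.mem_append, List.mem_cons, List.not_mem_nil, Option.some.injEq, or_false,
    not_or] at hA hB hC
  rw [Solves, hp] at h
  obtain ⟨E', hE'⟩ := Colors.move_triangle rfl rfl rfl hS hA.2.1.1 hA.2.2.1.1.1 hB.2.2.1
    (by simp [hA]) (by simp [hB]) (by simp [hC])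
    (by simpa [phraseBars] using crossingData_eq hpA)
    (by simpa [phraseBars, add_assoc] using crossingData_eq hpB)
    (by simpa [phraseBars, add_assoc] using crossingData_eq hpC) h
  refine ⟨E' ∘ f, .of_map f hf hproj (fun D i => ?_) (hq ▸ hE')⟩
  have hbars (D D' : p.Letter) : phraseBars [some D, some D'] = 0 := rfl
  have hswap (k : ℕ) (C C' D : p.Letter) :
      OccursAt k [some C, some C'] i D ↔ OccursAt k [some C', some C] i D := by
    simp [OccursAt, or_comm]
  simp only [hp, hq, occursAt_append, phraseBars_append, hbars, hswap _ B A, hswap _ C A,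
    hswap _ C B]

theorem symbolsAt_of_subsingleton {A : p.Letter} {i : Fin n}
    (h : ∀ j, A ∈ p.word j → j = i) (k : ℕ) : symbolsAt p.crossingData k A = [] := by
  have hfirst : p.firstComp A = i := h _ (mem_comps.1 (Finset.min'_mem _ _))
  have hsecond : p.secondComp A = i := h _ (mem_comps.1 (Finset.max'_mem _ _))
  simp [symbolsAt, crossingData, hfirst, hsecond]

section SameAlphabet

variable {L : Type} {hL hL' : Finite L} {proj proj' : L → AlphaV} {w w' : Fin n → List L}
  {hw : IsGaussPhrase w} {hw' : IsGaussPhrase w'} {E : L → G} {A : L} {i : Fin n}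

/-- The signs see the projection of a letter only if its occurrences lie in different components. -/
theorem symbolsAt_congr (hmem : ∀ B j, B ∈ w' j ↔ B ∈ w j) (hproj : ∀ B, B ≠ A → proj' B = proj B)
    (hA : proj' A = proj A ∨ ∀ j, A ∈ w j → j = i) (k : ℕ) (B : L) :
    symbolsAt (crossingData ⟨L, hL', proj', w', hw'⟩) k B =
      symbolsAt (crossingData ⟨L, hL, proj, w, hw⟩) k B := by
  have hocc (k : ℕ) : OccursAt 0 (flatPhrase w') k B ↔ OccursAt 0 (flatPhrase w) k B := by
    simp only [occursAt_flatPhrase, hmem]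
  by_cases hB : proj' B = proj B
  · have := crossingData_congr (p := ⟨L, hL', proj', w', hw'⟩) (q := ⟨L, hL, proj, w, hw⟩) hB hocc
    simp only [symbolsAt, this]
  · obtain rfl : B = A := not_imp_comm.1 (hproj B) hB
    have hB' : ∀ j, B ∈ w j → j = i := hA.resolve_left hB
    rw [symbolsAt_of_subsingleton (p := ⟨L, hL, proj, w, hw⟩) hB',
      symbolsAt_of_subsingleton (p := ⟨L, hL', proj', w', hw'⟩) fun j hj => hB' j ((hmem B j).1 hj)]

theorem Solves.selfCrossing (hA : ∀ j, A ∈ w j → j = i) (hproj : ∀ B, B ≠ A → proj' B = proj B)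
    (h : Solves ⟨L, hL, proj, w, hw⟩ P E) : Solves ⟨L, hL', proj', w, hw⟩ P E := by
  rw [Solves] at h ⊢
  rwa [symbols_congr (symbolsAt_congr (hL := hL) (hw := hw) (fun _ _ => Iff.rfl) hproj
    (Or.inr hA))]

theorem Solves.shift {x : List L} (hwi : w i = A :: x) (hwi' : w' i = x ++ [A])
    (hne : ∀ j, j ≠ i → w' j = w j) (hA : proj' A = proj A ∨ ∀ j, A ∈ w j → j = i)
    (hproj : ∀ B, B ≠ A → proj' B = proj B) (h : Solves ⟨L, hL, proj, w, hw⟩ P E) :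
    ∃ u, Solves ⟨L, hL', proj', w', hw'⟩ (P.conj u) E := by
  set d := crossingData ⟨L, hL, proj, w, hw⟩ with hd
  have hmem (B : L) (j : Fin n) : B ∈ w' j ↔ B ∈ w j := by
    by_cases hj : j = i
    · simp [hj, hwi, hwi', or_comm]
    · rw [hne j hj]
  refine ⟨Function.update 1 (i : ℕ) (run E ((i : ℕ), 1) (symbolsAt d i A)).2,
    solves_iff.2 fun j => ?_⟩
  rw [symbols_congr (symbolsAt_congr (hL := hL) (hw := hw) hmem hproj hA), ← hd]
  have hj := solves_iff.1 h j
  rw [← hd] at hj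
  by_cases hji : j = i
  · subst hji
    simp only [hwi, List.map_cons, symbols] at hj
    simp only [hwi', List.map_append, List.map_cons, List.map_nil, symbols_append,
      phraseBars_map_some, symbols, List.append_nil, add_zero]
    have ht : symbolsAt d j A = [] ∨
        ∃ D, symbolsAt d j A = [.above D] ∨ ∃ b, symbolsAt d j A = [.below D b] :=
      (symbolsAt_eq d j A).imp_right fun h => ⟨A, h⟩
    exact hj.rotate ht (by simp [bars_symbols]) (by simp)
  · rw [colors_conj_bar (by simp [bars_symbols])
      (by simp [Function.update_of_ne (Fin.val_injective.ne hji)])]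
    simpa only [hne j hji] using hj

end SameAlphabet

theorem Solves.of_mMove (hpq : MMove virtualData p q) (h : p.Solves P E) :
    ∃ u E', q.Solves (P.conj u) E' := by
  cases hpq with
  | shift hL proj proj' w w' hw hw' i A x hwi hwi' hne hA hA' hproj =>
    have hA'' : proj' A = proj A ∨ ∀ j, A ∈ w j → j = i := by
      by_cases hx : A ∈ x
      · obtain ⟨y, z, rfl⟩ := List.append_of_mem hx
        exact .inr fun j => hw.eq_of_mem (x := []) (y := y) (z := z) (by simpa using hwi)
      · exact .inl (hA' hx)
    obtain ⟨u, hu⟩ := h.shift hwi hwi' hne hA'' hproj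
    exact ⟨u, E, hu⟩
  | iso _ _ f hproj hword => exact ⟨1, _, by simpa only [P.conj_one] using h.iso f hproj hword⟩
  | h1 hL proj w hw A hL' w' hw' x y hp hq =>
    refine ⟨1, ?_⟩
    rw [P.conj_one]
    exact ⟨_, h.h1 (q := ⟨_, hL', _, w', hw'⟩) Subtype.val Subtype.val_injective
      (fun _ => rfl) (fun D => D.2) hp hq⟩
  | h2 hL proj w hw A B hL' w' hw' x y z hAB hp hq =>
    refine ⟨1, ?_⟩
    rw [P.conj_one]
    exact ⟨_, h.h2 (p := ⟨_, hL, proj, w, hw⟩) (q := ⟨_, hL', _, w', hw'⟩) Subtype.val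
      Subtype.val_injective (fun _ => rfl) (fun D => D.2.1) (fun D => D.2.2) hAB hp hq⟩
  | h3 hL proj w w' hw hw' A B C x y z t hS hp hq =>
    refine ⟨1, ?_⟩
    rw [P.conj_one]
    exact h.h3 (p := ⟨_, hL, proj, w, hw⟩) (q := ⟨_, hL, proj, w', hw'⟩) id
      Function.injective_id (fun _ => rfl) hS hp (by simpa using hq)
  | selfCrossing hL proj proj' w hw k A x y z hwk hA hproj =>
    refine ⟨1, E, ?_⟩
    rw [P.conj_one]
    exact h.selfCrossing (fun j => hw.eq_of_mem hwk) hproj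

end Nanophrase

/-! ### Values of words -/

/-- The value in a group of a word on letters and their formal inverses, given the values `E` of
the letters. -/
def wordVal {G : Type*} [Group G] {L : Type*} (E : L → G) (l : List (L × Bool)) : G :=
  FreeGroup.lift E (FreeGroup.mk l)

section WordVal

variable {G H L : Type*} [Group G] [Group H] (E : L → G)

@[simp]
theorem wordVal_nil : wordVal E [] = 1 := by simp [wordVal]

theorem wordVal_singleton (D : L) (b : Bool) : wordVal E [(D, b)] = signPow (E D) b := by
  simp [wordVal, signPow]

theorem wordVal_append (l l' : List (L × Bool)) :
    wordVal E (l ++ l') = wordVal E l * wordVal E l' := by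
  rw [wordVal, ← FreeGroup.mul_mk, map_mul]; rfl

theorem wordVal_invRev (l : List (L × Bool)) :
    wordVal E (FreeGroup.invRev l) = (wordVal E l)⁻¹ := by
  rw [wordVal, ← FreeGroup.inv_mk, map_inv]; rfl

variable {E}

theorem map_wordVal (f : G →* H) (l : List (L × Bool)) :
    f (wordVal E l) = wordVal (fun D => f (E D)) l := by
  simp only [wordVal, FreeGroup.lift_mk, map_list_prod, List.map_map, Function.comp_def,
    Bool.apply_cond f, map_inv]

theorem wordVal_congr {E' : L → G} {l : List (L × Bool)} (h : ∀ a ∈ l, E a.1 = E' a.1) :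
    wordVal E l = wordVal E' l := by
  simp only [wordVal, FreeGroup.lift_mk]
  exact congrArg List.prod (List.map_congr_left fun a ha => by rw [h a ha])

end WordVal

theorem mk_inv_mul_mul {G : Type*} [Group G] {K Γ Γ' : Subgroup G} [K.Normal] (hΓ : ⁅K, Γ⁆ ≤ Γ')
    {x g h : G} (hx : x ∈ K) (hgh : (g : G ⧸ Γ) = h) :
    ((g⁻¹ * x * g : G) : G ⧸ Γ') = (h⁻¹ * x * h : G) := by
  have hconj : g⁻¹ * x * g ∈ K := by simpa using ‹K.Normal›.conj_mem x hx g⁻¹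
  have hcomm := hΓ (Subgroup.commutator_mem_commutator (inv_mem hconj)
    (inv_mem (QuotientGroup.eq.1 hgh)))
  rw [QuotientGroup.eq]
  simpa [commutatorElement_def, mul_assoc] using hcomm

namespace Nanophrase

/-! ### Mixed letters and signed words -/

variable {n : ℕ} {p : Nanophrase AlphaV n} {D : p.Letter} {i : Fin n}

/-- The two occurrences of the letter lie in different components. -/
def IsMixed (p : Nanophrase AlphaV n) (D : p.Letter) : Prop := p.firstComp D ≠ p.secondComp D

theorem mem_word_firstComp (D : p.Letter) : D ∈ p.word (p.firstComp D) :=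
  mem_comps.1 (Finset.min'_mem _ (p.comps_nonempty D))

theorem mem_word_secondComp (D : p.Letter) : D ∈ p.word (p.secondComp D) :=
  mem_comps.1 (Finset.max'_mem _ (p.comps_nonempty D))

theorem firstComp_le (h : D ∈ p.word i) : p.firstComp D ≤ i :=
  Finset.min'_le _ _ (mem_comps.2 h)

theorem le_secondComp (h : D ∈ p.word i) : i ≤ p.secondComp D :=
  Finset.le_max' _ _ (mem_comps.2 h)

theorem IsMixed.lt (h : p.IsMixed D) : p.firstComp D < p.secondComp D :=
  lt_of_le_of_ne (firstComp_le (mem_word_secondComp D)) h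

theorem eq_firstComp_or_secondComp (h : D ∈ p.word i) :
    i = p.firstComp D ∨ i = p.secondComp D := by
  classical
  by_contra! hne
  have hfirst : p.firstComp D < i := lt_of_le_of_ne (firstComp_le h) hne.1.symm
  have hsecond : i < p.secondComp D := lt_of_le_of_ne (le_secondComp h) hne.2
  have hcard : ∑ k ∈ {p.firstComp D, i, p.secondComp D}, 1 ≤ ∑ k, (p.word k).count D := by
    refine (Finset.sum_le_sum fun k hk => List.count_pos_iff.2 ?_).trans
      (Finset.sum_le_sum_of_subset (Finset.subset_univ _))
    simp only [Finset.mem_insert, Finset.mem_singleton] at hk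
    rcases hk with rfl | rfl | rfl
    exacts [mem_word_firstComp D, h, mem_word_secondComp D]
  rw [IsGaussPhrase.sum_count p.gauss D,
    Finset.sum_insert (by simp [hfirst.ne, (hfirst.trans hsecond).ne]),
    Finset.sum_pair hsecond.ne] at hcard
  omega

theorem etaIndex_eq (D : p.Letter) :
    p.etaIndex D = if (p.proj D).signedFirst then p.secondComp D else p.firstComp D := by
  unfold etaIndex
  cases p.proj D <;> rfl

theorem mem_word_etaIndex (D : p.Letter) : D ∈ p.word (p.etaIndex D) := by
  rw [etaIndex_eq]
  split_ifs
  exacts [mem_word_secondComp D, mem_word_firstComp D]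

open Classical in
theorem signedLetter_eq (D : p.Letter) (i : Fin n) : p.signedLetter i D =
    if (i < p.secondComp D ∧ p.proj D = .bPlus) ∨ (p.firstComp D < i ∧ p.proj D = .aPlus) then
      [(D, true)]
    else if (i < p.secondComp D ∧ p.proj D = .aMinus) ∨
      (p.firstComp D < i ∧ p.proj D = .bMinus) then [(D, false)] else [] := by
  have hlt : (∃ k, i < k ∧ D ∈ p.word k) ↔ i < p.secondComp D :=
    ⟨fun ⟨_, hk, hD⟩ => hk.trans_le (le_secondComp hD), fun h => ⟨_, h, mem_word_secondComp D⟩⟩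
  have hgt : (∃ k, k < i ∧ D ∈ p.word k) ↔ p.firstComp D < i :=
    ⟨fun ⟨_, hk, hD⟩ => (firstComp_le hD).trans_lt hk, fun h => ⟨_, h, mem_word_firstComp D⟩⟩
  unfold signedLetter
  refine if_congr ?_ rfl (if_congr ?_ rfl rfl) <;> rw [hlt, hgt]

theorem symbolsAt_cases (h : D ∈ p.word i) :
    (¬ p.IsMixed D ∧ p.signedLetter i D = [] ∧ symbolsAt p.crossingData i D = []) ∨
      (p.IsMixed D ∧ p.etaIndex D = i ∧ p.signedLetter i D = [] ∧
        symbolsAt p.crossingData i D = [.above D]) ∨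
      (p.IsMixed D ∧ p.etaIndex D ≠ i ∧ ∃ b, p.signedLetter i D = [(D, b)] ∧
        symbolsAt p.crossingData i D = [.below D b]) := by
  rw [etaIndex_eq, signedLetter_eq]
  simp only [symbolsAt, crossingData, Fin.val_inj]
  by_cases hmix : p.IsMixed D
  · have hlt := hmix.lt
    simp only [hmix, not_true_eq_false, false_and, true_and, false_or]
    rcases eq_firstComp_or_secondComp h with rfl | rfl
    · cases p.proj D <;> simp [AlphaV.signedFirst, GaussSymbol.ofFirst, AlphaV.positive, hlt,
        hlt.ne, hlt.ne']
    · cases p.proj D <;> simp [AlphaV.signedFirst, GaussSymbol.ofSecond, AlphaV.positive, hlt,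
        hlt.ne, hlt.ne']
  · have heq : p.firstComp D = p.secondComp D := not_not.1 hmix
    obtain rfl : i = p.secondComp D := by
      rcases eq_firstComp_or_secondComp h with h | h
      exacts [h.trans heq, h]
    simp [hmix, heq]

theorem isMixed_of_mem_flatMap {v : List p.Letter} (hv : v ⊆ p.word i) :
    ∀ a ∈ v.flatMap (p.signedLetter i), p.IsMixed a.1 := by
  intro a ha
  obtain ⟨D, hD, ha⟩ := List.mem_flatMap.1 ha
  rcases symbolsAt_cases (hv hD) with ⟨-, hl, -⟩ | ⟨-, -, hl, -⟩ | ⟨hmix, -, b, hl, -⟩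
  · simp [hl] at ha
  · simp [hl] at ha
  · rw [hl, List.mem_singleton] at ha
    rwa [ha]

theorem isMixed_of_mem_signedWord : ∀ a ∈ p.signedWord i, p.IsMixed a.1 :=
  isMixed_of_mem_flatMap (List.Subset.refl _)

theorem isMixed_of_mem_truncWord : ∀ a ∈ p.truncWord D, p.IsMixed a.1 :=
  isMixed_of_mem_flatMap (List.takeWhile_subset _)

theorem truncWord_eq {l r : List p.Letter} (h : p.word (p.etaIndex D) = l ++ D :: r) (hD : D ∉ l) :
    p.truncWord D = l.flatMap (p.signedLetter (p.etaIndex D)) := by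
  have hne : ∀ C ∈ l, C ≠ D := fun C hC hCD => hD (hCD ▸ hC)
  unfold truncWord
  rw [h, List.takeWhile_append_of_pos (by simpa using hne), List.takeWhile_cons_of_neg (by simp),
    List.append_nil]

/-! ### The Wirtinger relations in terms of truncated signed words -/

open PeripheralSystem

variable {G : Type*} [Group G] {P : PeripheralSystem G} {E : p.Letter → G}

theorem run_symbols (E : p.Letter → G) {v : List p.Letter} (hv : v ⊆ p.word i) :
    GaussSymbol.run E (i, 1) (symbols p.crossingData i (v.map some)) =
      ((i : ℕ), wordVal E (v.flatMap (p.signedLetter i))) := by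
  induction v using List.reverseRecOn with
  | nil => simp [symbols, GaussSymbol.run]
  | append_singleton v D ih =>
    obtain ⟨hv, hD⟩ := List.append_subset.1 hv
    rw [List.map_append, symbols_append, GaussSymbol.run_append, ih hv, List.flatMap_append,
      wordVal_append]
    rcases symbolsAt_cases (hD (List.mem_singleton_self D)) with
      ⟨-, hl, hs⟩ | ⟨-, -, hl, hs⟩ | ⟨-, -, b, hl, hs⟩ <;>
      simp [symbols, hl, hs, GaussSymbol.run, GaussSymbol.step, wordVal_singleton]

theorem colors_symbols_iff {v : List p.Letter} (hv : v ⊆ p.word i) :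
    P.Colors E (i, 1) (symbols p.crossingData i (v.map some)) ↔
      ∀ l D, l ++ [D] <+: v → p.IsMixed D → p.etaIndex D = i →
        E D = (wordVal E (l.flatMap (p.signedLetter i)))⁻¹ * P.meridian i *
          wordVal E (l.flatMap (p.signedLetter i)) := by
  induction v using List.reverseRecOn with
  | nil => simp [symbols, Colors]
  | append_singleton v D ih =>
    obtain ⟨hv, hD⟩ := List.append_subset.1 hv
    have hlast : P.Colors E (GaussSymbol.run E (i, 1) (symbols p.crossingData i (v.map some)))
        (symbolsAt p.crossingData i D) ↔ (p.IsMixed D → p.etaIndex D = i →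
          E D = (wordVal E (v.flatMap (p.signedLetter i)))⁻¹ * P.meridian i *
            wordVal E (v.flatMap (p.signedLetter i))) := by
      rw [run_symbols E hv]
      rcases symbolsAt_cases (hD (List.mem_singleton_self D)) with
        ⟨hmix, -, hs⟩ | ⟨hmix, heta, -, hs⟩ | ⟨-, heta, b, -, hs⟩
      · simp [hmix, hs, Colors]
      · simp [hmix, hs, Colors, ColorsAt, heta]
      · simp [hs, Colors, ColorsAt, heta]
    rw [List.map_append, symbols_append, phraseBars_map_some, add_zero, colors_append, ih hv,
      List.map_singleton, symbols, symbols, List.append_nil, hlast]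
    refine ⟨fun ⟨hv', hD'⟩ l C hl => ?_, fun h => ⟨fun l C hl => ?_, ?_⟩⟩
    · rcases List.prefix_concat_iff.1 hl with hl | hl
      · obtain ⟨rfl, hC⟩ := List.append_inj' hl rfl
        obtain rfl := List.singleton_inj.1 hC
        exact hD'
      · exact hv' l C hl
    · exact h l C (hl.trans (List.prefix_append v [D]))
    · exact h v D (List.prefix_refl _)

theorem solves_iff_truncWord :
    p.Solves P E ↔
      (∀ D, p.IsMixed D → E D = (wordVal E (p.truncWord D))⁻¹ * P.meridian (p.etaIndex D) *
        wordVal E (p.truncWord D)) ∧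
      ∀ i : Fin n, (wordVal E (p.signedWord i))⁻¹ * P.longitude i ∈ P.meridianSubgroup i := by
  have hbar (i : Fin n) : P.Colors E (GaussSymbol.run E (i, 1)
      (symbols p.crossingData i ((p.word i).map some))) [.bar] ↔
        (wordVal E (p.signedWord i))⁻¹ * P.longitude i ∈ P.meridianSubgroup i := by
    rw [run_symbols E (List.Subset.refl _)]
    simp [Colors, ColorsAt, signedWord]
  simp only [solves_iff, colors_append, hbar, colors_symbols_iff (List.Subset.refl _), forall_and]
  refine and_congr ⟨fun h D hD => ?_, fun h i l D hl hD hi => ?_⟩ Iff.rfl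
  · obtain ⟨l, r, hw, hl⟩ := List.eq_append_cons_of_mem (mem_word_etaIndex D)
    rw [truncWord_eq hw hl]
    exact h _ l D ⟨r, by simp [hw]⟩ hD rfl
  · obtain ⟨r, hr⟩ := hl
    have hDl : D ∉ l := by
      intro hDl
      obtain ⟨x, y, rfl⟩ := List.append_of_mem hDl
      have heq {j : Fin n} : D ∈ p.word j → j = i :=
        p.gauss.eq_of_mem (x := x) (y := y) (z := r) (by simp [← hr])
      exact hD ((heq (mem_word_firstComp D)).trans (heq (mem_word_secondComp D)).symm)
    subst hi
    rw [← truncWord_eq (r := r) (by simp [← hr]) hDl]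
    exact h D hD

/-! ### Approximation by the words `ρ^q` -/

/-- The value of `ρ^{d+2}(D)` when the `k`th generator takes the value `m k`. -/
noncomputable def rhoVal (p : Nanophrase AlphaV n) (m : Fin n → G) (d : ℕ) (D : p.Letter) : G :=
  wordVal m (p.eta (p.rho d [(D, true)]))

variable {m : Fin n → G}

theorem wordVal_eta_rho (d : ℕ) (l : List (p.Letter × Bool)) :
    wordVal m (p.eta (p.rho d l)) = wordVal (p.rhoVal m d) l := by
  induction l with
  | nil => simp [rho_nil, eta]
  | cons a l ih =>
    have hsingle : wordVal m (p.eta (p.rho d [a])) = wordVal (p.rhoVal m d) [a] := by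
      obtain ⟨D, _ | _⟩ := a
      · have hinv : [(D, false)] = FreeGroup.invRev [(D, true)] := by simp [FreeGroup.invRev]
        rw [hinv, rho_invRev, eta_invRev, wordVal_invRev, wordVal_invRev, wordVal_singleton]
        rfl
      · rw [wordVal_singleton]; rfl
    rw [← List.singleton_append, rho_append, eta_append, wordVal_append, wordVal_append, hsingle,
      ih]

theorem rhoVal_zero (D : p.Letter) : p.rhoVal m 0 D = m (p.etaIndex D) := by
  simp [rhoVal, rho, eta, wordVal_singleton, signPow]

theorem rhoVal_succ (d : ℕ) (D : p.Letter) :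
    p.rhoVal m (d + 1) D = (wordVal (p.rhoVal m d) (p.truncWord D))⁻¹ * m (p.etaIndex D) *
      wordVal (p.rhoVal m d) (p.truncWord D) := by
  have heta : wordVal m (p.eta [(D, true)]) = m (p.etaIndex D) := rhoVal_zero D
  rw [← wordVal_eta_rho, rhoVal, ← heta, ← wordVal_invRev, ← eta_invRev, ← rho_invRev,
    ← wordVal_append, ← wordVal_append, ← eta_append, ← eta_append]
  simp [rho]

theorem solves_rhoVal {d : ℕ} (hm : ∀ k : Fin n, P.meridian k = m k)
    (hstable : p.rhoVal m (d + 1) = p.rhoVal m d)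
    (hlong : ∀ i : Fin n, P.longitude i = wordVal (p.rhoVal m d) (p.signedWord i)) :
    p.Solves P (p.rhoVal m d) := by
  refine solves_iff_truncWord.2 ⟨fun D _ => ?_, fun i => ?_⟩
  · rw [hm, ← rhoVal_succ, hstable]
  · rw [hlong, inv_mul_cancel]
    exact one_mem _

/-- Each step of the recursion that defines `ρ^q` improves the approximation, because the values of
the truncated words enter only through conjugates of the generators. -/
theorem Solves.mk_wordVal_rhoVal (h : p.Solves P E) (hm : ∀ k : Fin n, P.meridian k = m k)
    (Γ : ℕ → Subgroup G) [∀ q, (Γ q).Normal] (hΓ₀ : Γ 0 = ⊤) (hΓ₁ : ∀ k, m k ∈ Γ 1)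
    (hΓ : ∀ q, ⁅Γ 1, Γ q⁆ ≤ Γ (q + 1)) (q : ℕ) {l : List (p.Letter × Bool)}
    (hl : ∀ a ∈ l, p.IsMixed a.1) :
    ((wordVal (p.rhoVal m q) l : G) : G ⧸ Γ (q + 1)) = (wordVal E l : G) := by
  obtain ⟨hE, -⟩ := solves_iff_truncWord.1 h
  have hwords (q : ℕ) {F : p.Letter → G} (hF : ∀ D, p.IsMixed D → (F D : G ⧸ Γ q) = E D)
      {l : List (p.Letter × Bool)} (hl : ∀ a ∈ l, p.IsMixed a.1) :
      ((wordVal F l : G) : G ⧸ Γ q) = (wordVal E l : G) := by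
    have hmap := wordVal_congr (E := fun D => QuotientGroup.mk' (Γ q) (F D))
      (E' := fun D => QuotientGroup.mk' (Γ q) (E D)) fun a ha => hF a.1 (hl a ha)
    rwa [← map_wordVal, ← map_wordVal] at hmap
  refine hwords _ (fun D hD => ?_) hl
  induction q generalizing D with
  | zero =>
    have htrunc : ((1 : G) : G ⧸ Γ 0) = (wordVal E (p.truncWord D) : G) := by
      rw [QuotientGroup.eq, hΓ₀]; trivial
    rw [hE D hD, hm, rhoVal_zero]
    simpa using mk_inv_mul_mul (hΓ 0) (hΓ₁ (p.etaIndex D)) htrunc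
  | succ q ih =>
    rw [hE D hD, hm, rhoVal_succ]
    exact mk_inv_mul_mul (hΓ _) (hΓ₁ _) (hwords _ ih isMixed_of_mem_truncWord)

end Nanophrase

/-! ### Congruence subgroups of units -/

section UnitsCongr

variable {R : Type*} [Ring R] {I J K : TwoSidedIdeal R} {g h : Rˣ}

/-- The group of the units that are congruent to `1` modulo a two-sided ideal. -/
def unitsCongr (I : TwoSidedIdeal R) : Subgroup Rˣ :=
  (Units.map (I.ringCon.mk' : R →* I.ringCon.Quotient)).ker

instance unitsCongr_normal (I : TwoSidedIdeal R) : (unitsCongr I).Normal :=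
  MonoidHom.normal_ker _

theorem mem_unitsCongr : g ∈ unitsCongr I ↔ (g : R) - 1 ∈ I := by
  rw [← I.rel_iff, ← RingCon.eq, unitsCongr, MonoidHom.mem_ker, Units.ext_iff]
  rfl

theorem mk_eq_mk_iff : (g : Rˣ ⧸ unitsCongr I) = h ↔ (g : R) - h ∈ I := by
  rw [eq_comm, QuotientGroup.eq, unitsCongr, MonoidHom.mem_ker, map_mul, map_inv, inv_mul_eq_one,
    eq_comm, Units.ext_iff, ← I.rel_iff, ← RingCon.eq]
  rfl

theorem commutator_unitsCongr_le (hJK : ∀ x ∈ J, ∀ y ∈ K, x * y ∈ I)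
    (hKJ : ∀ y ∈ K, ∀ x ∈ J, y * x ∈ I) : ⁅unitsCongr J, unitsCongr K⁆ ≤ unitsCongr I := by
  rw [Subgroup.commutator_le]
  intro g hg h hh
  rw [mem_unitsCongr] at hg hh
  have hsub : ((g * h : Rˣ) : R) - (h * g : Rˣ) =
      ((g : R) - 1) * (h - 1) - ((h : R) - 1) * (g - 1) := by
    push_cast
    noncomm_ring
  have hgh : ((g * h : Rˣ) : Rˣ ⧸ unitsCongr I) = (h * g : Rˣ) :=
    mk_eq_mk_iff.2 (hsub ▸ I.sub_mem (hJK _ hg _ hh) (hKJ _ hh _ hg))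
  rw [← QuotientGroup.eq_one_iff, commutatorElement_def, mul_assoc, ← mul_inv_rev,
    QuotientGroup.mk_mul, QuotientGroup.mk_inv, hgh, mul_inv_cancel]

/-- The image of a congruence subgroup in the quotient by a smaller one. -/
def unitsCongrMod (I J : TwoSidedIdeal R) : Subgroup (Rˣ ⧸ unitsCongr I) :=
  (unitsCongr J).map (QuotientGroup.mk' _)

instance unitsCongrMod_normal (I J : TwoSidedIdeal R) : (unitsCongrMod I J).Normal :=
  (unitsCongr_normal J).map _ (QuotientGroup.mk'_surjective _)

theorem mk_mem_unitsCongrMod (hIJ : I ≤ J) :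
    (g : Rˣ ⧸ unitsCongr I) ∈ unitsCongrMod I J ↔ (g : R) - 1 ∈ J := by
  refine ⟨?_, fun hg => ⟨g, mem_unitsCongr.2 hg, rfl⟩⟩
  rintro ⟨u, hu, hug⟩
  simpa using J.add_mem (hIJ (mk_eq_mk_iff.1 hug.symm)) (mem_unitsCongr.1 hu)

theorem unitsCongrMod_top : unitsCongrMod I ⊤ = ⊤ := by
  rw [eq_top_iff]
  rintro g -
  obtain ⟨g, rfl⟩ := QuotientGroup.mk_surjective g
  exact (mk_mem_unitsCongrMod le_top).2 trivial

theorem unitsCongrMod_self : unitsCongrMod I I = ⊥ := by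
  rw [unitsCongrMod, QuotientGroup.map_mk'_self]

theorem commutator_unitsCongrMod_le {I' : TwoSidedIdeal R} (hJK : ∀ x ∈ J, ∀ y ∈ K, x * y ∈ I)
    (hKJ : ∀ y ∈ K, ∀ x ∈ J, y * x ∈ I) :
    ⁅unitsCongrMod I' J, unitsCongrMod I' K⁆ ≤ unitsCongrMod I' I := by
  rw [unitsCongrMod, unitsCongrMod, ← Subgroup.map_commutator]
  exact Subgroup.map_mono (commutator_unitsCongr_le hJK hKJ)

theorem commute_of_mem_unitsCongrMod (hJ : ∀ x ∈ J, ∀ y ∈ J, x * y ∈ I) {a b : Rˣ ⧸ unitsCongr I}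
    (ha : a ∈ unitsCongrMod I J) (hb : b ∈ unitsCongrMod I J) : Commute a b := by
  have hab := commutator_unitsCongrMod_le hJ hJ (Subgroup.commutator_mem_commutator ha hb)
  rwa [unitsCongrMod_self, Subgroup.mem_bot, commutatorElement_eq_one_iff_commute] at hab

end UnitsCongr

/-! ### Divisibility of coefficients -/

/-- A set of monomials that contains the prefixes and suffixes of its elements, so that the
divisibility of all its coefficients by a given integer defines an ideal. -/
def FactorClosed {σ : Type*} (V : Set (List σ)) : Prop :=
  ∀ c ∈ V, ∀ k, c.take k ∈ V ∧ c.drop k ∈ V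

section Monomials

variable {σ : Type*} {W : Set (List σ)}

/-- The monomials of `W` without the variable `h`. -/
def avoiding (W : Set (List σ)) (h : σ) : Set (List σ) := {c | c ∈ W ∧ h ∉ c}

/-- The monomials of `W` of degree less than `q`. -/
def shorter (W : Set (List σ)) (q : ℕ) : Set (List σ) := {c | c ∈ W ∧ c.length < q}

theorem FactorClosed.avoiding (hW : FactorClosed W) (h : σ) : FactorClosed (avoiding W h) :=
  fun c hc k => ⟨⟨(hW c hc.1 k).1, fun hh => hc.2 (List.mem_of_mem_take hh)⟩,
    ⟨(hW c hc.1 k).2, fun hh => hc.2 (List.mem_of_mem_drop hh)⟩⟩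

theorem FactorClosed.shorter (hW : FactorClosed W) (q : ℕ) : FactorClosed (shorter W q) :=
  fun c hc k => ⟨⟨(hW c hc.1 k).1, (List.take_sublist k c).length_le.trans_lt hc.2⟩,
    ⟨(hW c hc.1 k).2, (List.drop_sublist k c).length_le.trans_lt hc.2⟩⟩

end Monomials

namespace NCSeries

variable {σ : Type*} {M : ℤ} {V V' W : Set (List σ)} {f g : NCSeries σ} {h : σ} {c : List σ}

theorem dvd_coeff_mul (hfg : ∀ k, M ∣ f.coeff (c.take k) ∨ M ∣ g.coeff (c.drop k)) :
    M ∣ (f * g).coeff c := by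
  rw [coeff_mul]
  exact Finset.dvd_sum fun k _ => (hfg k).elim (·.mul_right _) (·.mul_left _)

/-- The ideal of the series whose coefficients on `V` are divisible by `M`. -/
def vanishing (M : ℤ) (hV : FactorClosed V) : TwoSidedIdeal (NCSeries σ) :=
  .mk' {f | ∀ c ∈ V, M ∣ f.coeff c}
    (fun _ _ => dvd_zero M)
    (fun hf hg c hc => dvd_add (hf c hc) (hg c hc))
    (fun hf c hc => (hf c hc).neg_right)
    (fun hg c hc => dvd_coeff_mul fun k => .inr (hg _ (hV c hc k).2))
    (fun hf c hc => dvd_coeff_mul fun k => .inl (hf _ (hV c hc k).1))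

variable {hV : FactorClosed V} {hV' : FactorClosed V'} {hW : FactorClosed W}

theorem mem_vanishing : f ∈ vanishing M hV ↔ ∀ c ∈ V, M ∣ f.coeff c :=
  TwoSidedIdeal.mem_mk' ..

theorem vanishing_le (hVW : V ⊆ W) : vanishing M hW ≤ vanishing M hV :=
  fun _ hf => mem_vanishing.2 fun c hc => mem_vanishing.1 hf c (hVW hc)

theorem mul_mem_vanishing (hf : f ∈ vanishing M hV) (hg : g ∈ vanishing M hV')
    (hVW : ∀ c ∈ W, ∀ k, c.take k ∈ V ∨ c.drop k ∈ V') : f * g ∈ vanishing M hW :=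
  mem_vanishing.2 fun c hc => dvd_coeff_mul fun k =>
    (hVW c hc k).imp (mem_vanishing.1 hf _) (mem_vanishing.1 hg _)

/-- Two factors that both contain `h` cannot make up a monomial without repetitions. -/
theorem mul_mem_vanishing_of_avoiding (hnd : ∀ c ∈ W, c.Nodup)
    (hf : f ∈ vanishing M (hW.avoiding h)) (hg : g ∈ vanishing M (hW.avoiding h)) :
    f * g ∈ vanishing M hW := by
  refine mul_mem_vanishing hf hg fun c hc k => ?_
  by_contra! hno
  have htake : h ∈ c.take k := by_contra fun hh => hno.1 ⟨(hW c hc k).1, hh⟩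
  have hdrop : h ∈ c.drop k := by_contra fun hh => hno.2 ⟨(hW c hc k).2, hh⟩
  have hdisj := hnd c hc
  rw [← List.take_append_drop k c, List.nodup_append] at hdisj
  exact hdisj.2.2 h htake h hdrop rfl

theorem mul_mem_vanishing_of_shorter_one_left {q : ℕ} (hf : f ∈ vanishing M (hW.shorter 1))
    (hg : g ∈ vanishing M (hW.shorter q)) : f * g ∈ vanishing M (hW.shorter (q + 1)) := by
  refine mul_mem_vanishing hf hg fun c hc k => ?_
  have hlen := congrArg List.length (List.take_append_drop k c)
  have hlt := hc.2
  rw [List.length_append] at hlen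
  by_cases hk : (c.take k).length < 1
  · exact .inl ⟨(hW c hc.1 k).1, hk⟩
  · exact .inr ⟨(hW c hc.1 k).2, by lia⟩

theorem mul_mem_vanishing_of_shorter_one_right {q : ℕ} (hf : f ∈ vanishing M (hW.shorter q))
    (hg : g ∈ vanishing M (hW.shorter 1)) : f * g ∈ vanishing M (hW.shorter (q + 1)) := by
  refine mul_mem_vanishing hf hg fun c hc k => ?_
  have hlen := congrArg List.length (List.take_append_drop k c)
  have hlt := hc.2
  rw [List.length_append] at hlen
  by_cases hk : (c.drop k).length < 1
  · exact .inr ⟨(hW c hc.1 k).2, hk⟩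
  · exact .inl ⟨(hW c hc.1 k).1, by lia⟩

theorem vanishing_shorter_zero : vanishing M (hW.shorter 0) = ⊤ :=
  eq_top_iff.2 fun _ _ => mem_vanishing.2 fun _ hc => absurd hc.2 (Nat.not_lt_zero _)

theorem vanishing_shorter_of_length_lt {q : ℕ} (hq : ∀ c ∈ W, c.length < q) :
    vanishing M (hW.shorter q) = vanishing M hW :=
  le_antisymm (vanishing_le fun c hc => ⟨hc, hq c hc⟩) (vanishing_le fun _ hc => hc.1)

end NCSeries

namespace NCSeries

/-! ### Substitution -/

variable {σ : Type*}

/-- The series `∑ f_w κ_w`, in which the series `κ h` are substituted for the variables of `f`. It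
is used only for triangular families `κ`, which make all coefficients finite sums. -/
noncomputable def subst (κ : σ → NCSeries σ) (f : NCSeries σ) : NCSeries σ :=
  fun c => ∑ᶠ w : List σ, f.coeff w * (w.map κ).prod.coeff c

/-- Families of the form `κ h = h + ⋯`, where all terms of `κ h` contain the variable `h`. -/
structure IsTriangular (κ : σ → NCSeries σ) : Prop where
  coeff_eq_zero : ∀ h c, h ∉ c → (κ h).coeff c = 0
  coeff_singleton : ∀ h, (κ h).coeff [h] = 1

namespace IsTriangular

variable {κ : σ → NCSeries σ} {f g : NCSeries σ} {c : List σ}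

theorem sublist_of_coeff_prod_ne_zero (hκ : IsTriangular κ) {w : List σ}
    (hw : (w.map κ).prod.coeff c ≠ 0) : w.Sublist c := by
  induction w generalizing c with
  | nil => exact List.nil_sublist c
  | cons h w ih =>
    rw [List.map_cons, List.prod_cons, coeff_mul] at hw
    obtain ⟨k, -, hk⟩ := Finset.exists_ne_zero_of_sum_ne_zero hw
    have hmem : h ∈ c.take k := by_contra fun hh => hk (by rw [hκ.coeff_eq_zero h _ hh, zero_mul])
    simpa using (List.singleton_sublist.2 hmem).append (ih (right_ne_zero_of_mul hk))

theorem coeff_prod_self (hκ : IsTriangular κ) (w : List σ) : (w.map κ).prod.coeff w = 1 := by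
  induction w with
  | nil => rfl
  | cons h w ih =>
    rw [List.map_cons, List.prod_cons, coeff_mul, Finset.sum_eq_single 1]
    · simp [hκ.coeff_singleton, ih]
    · intro k hk hk₁
      by_contra hne
      rcases Nat.eq_zero_or_pos k with rfl | hpos
      · exact hne (by rw [List.take_zero, hκ.coeff_eq_zero h [] (by simp), zero_mul])
      · have hlen := (hκ.sublist_of_coeff_prod_ne_zero (right_ne_zero_of_mul hne)).length_le
        simp only [List.length_drop, List.length_cons, Finset.mem_range] at hlen hk
        lia
    · simp

theorem coeff_subst (hκ : IsTriangular κ) {s : Finset (List σ)}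
    (hs : ∀ w, f.coeff w ≠ 0 → w.Sublist c → w ∈ s) :
    (subst κ f).coeff c = ∑ w ∈ s, f.coeff w * (w.map κ).prod.coeff c :=
  finsum_eq_sum_of_support_subset _ fun w hw =>
    hs w (left_ne_zero_of_mul hw) (hκ.sublist_of_coeff_prod_ne_zero (right_ne_zero_of_mul hw))

theorem dvd_coeff_subst_sub (hκ : IsTriangular κ) {M : ℤ}
    (hf : ∀ w, w.Sublist c → w ≠ c → M ∣ f.coeff w) :
    M ∣ (subst κ f).coeff c - f.coeff c := by
  classical
  rw [hκ.coeff_subst (s := c.sublists.toFinset) fun w _ hw => by simpa using hw,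
    ← Finset.add_sum_erase _ _ (a := c) (by simp), hκ.coeff_prod_self, mul_one,
    add_sub_cancel_left]
  refine Finset.dvd_sum fun w hw => (hf w ?_ (Finset.ne_of_mem_erase hw)).mul_right _
  simpa using Finset.mem_of_mem_erase hw

theorem dvd_coeff_subst_sub_of_subst (hκ : IsTriangular κ) {M : ℤ}
    (hf : ∀ w, w.Sublist c → w ≠ c → M ∣ (subst κ f).coeff w) :
    M ∣ (subst κ f).coeff c - f.coeff c := by
  induction hn : c.length using Nat.strong_induction_on generalizing c with
  | _ n ih =>
    refine hκ.dvd_coeff_subst_sub fun w hw hwc => ?_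
    have hlt : w.length < n := hn ▸ hw.length_le.lt_of_ne fun hlen => hwc (hw.eq_of_length hlen)
    refine (dvd_sub_right (hf w hw hwc)).1 (ih _ hlt (fun v hv _ => ?_) rfl)
    exact hf v (hv.trans hw) fun hvc => hwc (hw.antisymm (hvc ▸ hv))

theorem subst_one (hκ : IsTriangular κ) : subst κ 1 = 1 := by
  ext c
  rw [hκ.coeff_subst (s := {[]}) fun w hw _ => by simpa [coeff_one] using hw]
  simp [coeff_one]

theorem subst_add (hκ : IsTriangular κ) : subst κ (f + g) = subst κ f + subst κ g := by
  classical
  ext c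
  have hmem : ∀ w : List σ, w.Sublist c → w ∈ c.sublists.toFinset := by simp
  rw [coeff_add, hκ.coeff_subst fun w _ => hmem w, hκ.coeff_subst fun w _ => hmem w,
    hκ.coeff_subst fun w _ => hmem w, ← Finset.sum_add_distrib]
  simp only [coeff_add, add_mul]

theorem subst_X_mul (hκ : IsTriangular κ) (h : σ) : subst κ (X h * f) = κ h * subst κ f := by
  classical
  ext c
  have hcons : Function.Injective (List.cons h) := List.cons_injective
  rw [hκ.coeff_subst (s := c.sublists.toFinset.image (List.cons h)), Finset.sum_image hcons.injOn,
    coeff_mul]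
  · simp only [coeff_X_mul, if_true, List.map_cons, List.prod_cons, coeff_mul (κ h),
      Finset.mul_sum]
    rw [Finset.sum_comm]
    refine Finset.sum_congr rfl fun k _ => ?_
    rw [hκ.coeff_subst (s := c.sublists.toFinset) fun w _ hw => by
      simpa using hw.trans (List.drop_sublist k c), Finset.mul_sum]
    exact Finset.sum_congr rfl fun w _ => mul_left_comm ..
  · rintro (_ | ⟨a, w⟩) hne hw
    · simp [coeff_mul_nil, coeff_X] at hne
    · obtain rfl : a = h := by_contra fun ha => hne (by rw [coeff_X_mul, if_neg ha])
      simpa using (List.sublist_cons_self a w).trans hw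

end IsTriangular

/-- The unit `1 + κ_h`. -/
noncomputable def letterUnit (h : σ) : (NCSeries σ)ˣ :=
  ⟨1 + X h, altGeom h, one_add_X_mul_altGeom h, altGeom_mul_one_add_X h⟩

theorem letterUnit_sub_one (h : σ) : (letterUnit h : NCSeries σ) - 1 = X h :=
  add_sub_cancel_left 1 (X h)

theorem IsTriangular.subst_wordVal {m : σ → (NCSeries σ)ˣ}
    (hm : IsTriangular fun h => (m h : NCSeries σ) - 1) (l : List (σ × Bool)) :
    subst (fun h => (m h : NCSeries σ) - 1) (wordVal letterUnit l : (NCSeries σ)ˣ) =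
      (wordVal m l : (NCSeries σ)ˣ) := by
  have hletter : ∀ h f, subst (fun h => (m h : NCSeries σ) - 1) ((letterUnit h : NCSeries σ) * f) =
      (m h : NCSeries σ) * subst (fun h => (m h : NCSeries σ) - 1) f := by
    intro h f
    rw [show (letterUnit h : NCSeries σ) = 1 + X h from rfl, add_mul, one_mul, hm.subst_add,
      hm.subst_X_mul]
    noncomm_ring
  induction l with
  | nil => rw [wordVal_nil, wordVal_nil, Units.val_one, hm.subst_one]
  | cons a l ih =>
    obtain ⟨h, b⟩ := a
    rw [← List.singleton_append, wordVal_append, wordVal_append, wordVal_singleton,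
      wordVal_singleton, Units.val_mul, Units.val_mul]
    cases b with
    | true => rw [← ih]; exact hletter h _
    | false =>
      rw [← ih, signPow, signPow, cond_false, cond_false, Units.eq_inv_mul_iff_mul_eq, ← hletter,
        Units.mul_inv_cancel_left]

/-- The condition on the proper subwords of `c` concerns the value of the word at `m`; as the family
`m h - 1` is triangular, it passes to the expansion of the word. -/
theorem IsTriangular.dvd_coeff_wordVal_sub {M : ℤ} {m : σ → (NCSeries σ)ˣ}
    (hm : IsTriangular fun h => (m h : NCSeries σ) - 1) {l : List (σ × Bool)} {c : List σ}
    (hl : ∀ d, d.Sublist c → d ≠ c →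
      M ∣ (((wordVal m l : (NCSeries σ)ˣ) : NCSeries σ) - 1).coeff d) :
    M ∣ (((wordVal m l : (NCSeries σ)ˣ) : NCSeries σ) -
      (wordVal letterUnit l : (NCSeries σ)ˣ)).coeff c := by
  set f : NCSeries σ := (wordVal letterUnit l : (NCSeries σ)ˣ) - 1 with hf
  have hsubst : subst (fun h => (m h : NCSeries σ) - 1) f = (wordVal m l : (NCSeries σ)ˣ) - 1 := by
    have hadd := hm.subst_add (f := f) (g := 1)
    rw [hf, sub_add_cancel, hm.subst_wordVal, hm.subst_one, ← hf] at hadd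
    exact eq_sub_of_add_eq hadd.symm
  have hc := hm.dvd_coeff_subst_sub_of_subst (f := f) (hsubst ▸ hl)
  rwa [hsubst, ← coeff_sub, hf, sub_sub_sub_cancel_right] at hc

/-! ### Conjugation -/

section Conjugation

variable {M : ℤ} {f : NCSeries σ} {c : List σ}

theorem dvd_coeff_mul_sub_coeff_mul_coeff_nil
    (hf : ∀ d, d.Sublist c → d ≠ c → M ∣ f.coeff d) (g : NCSeries σ) :
    M ∣ (f * g).coeff c - f.coeff c * g.coeff [] := by
  rw [coeff_mul, Finset.sum_range_succ, List.take_length, List.drop_length, add_sub_cancel_right]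
  refine Finset.dvd_sum fun k hk => (hf _ (List.take_sublist k c) fun h => ?_).mul_right _
  exact (Finset.mem_range.1 hk).not_ge (List.take_eq_self_iff c |>.1 h)

theorem dvd_coeff_mul_sub_coeff_nil_mul_coeff
    (hf : ∀ d, d.Sublist c → d ≠ c → M ∣ f.coeff d) (g : NCSeries σ) :
    M ∣ (g * f).coeff c - g.coeff [] * f.coeff c := by
  rw [coeff_mul, Finset.sum_range_succ', List.take_zero, List.drop_zero, add_sub_cancel_right]
  refine Finset.dvd_sum fun k hk => (hf _ (List.drop_sublist _ c) fun h => ?_).mul_left _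
  have hlen := congrArg List.length h
  rw [List.length_drop] at hlen
  have := Finset.mem_range.1 hk
  lia

theorem dvd_coeff_conj_sub (hf : ∀ d, d.Sublist c → d ≠ c → M ∣ f.coeff d)
    (u : (NCSeries σ)ˣ) :
    M ∣ (((u⁻¹ : (NCSeries σ)ˣ) : NCSeries σ) * f * u).coeff c - f.coeff c := by
  set v : NCSeries σ := ((u⁻¹ : (NCSeries σ)ˣ) : NCSeries σ)
  have hvf : ∀ d, d.Sublist c → d ≠ c → M ∣ (v * f).coeff d := fun d hd hdc =>
    dvd_coeff_mul fun k => .inr <| hf _ ((List.drop_sublist k d).trans hd) fun h =>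
      hdc <| hd.antisymm <| h ▸ List.drop_sublist k d
  have hunit : v.coeff [] * (u : NCSeries σ).coeff [] = 1 := by
    rw [← coeff_mul_nil, Units.inv_mul]; rfl
  have hright := dvd_coeff_mul_sub_coeff_mul_coeff_nil hvf u
  have hleft := (dvd_coeff_mul_sub_coeff_nil_mul_coeff hf v).mul_right ((u : NCSeries σ).coeff [])
  rw [sub_mul, mul_right_comm, hunit, one_mul] at hleft
  simpa only [sub_add_sub_cancel] using dvd_add hright hleft

theorem val_conj_sub_one (g u : (NCSeries σ)ˣ) :
    ((u⁻¹ * g * u : (NCSeries σ)ˣ) : NCSeries σ) - 1 =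
      ((u⁻¹ : (NCSeries σ)ˣ) : NCSeries σ) * (g - 1) * u := by
  rw [Units.val_mul, Units.val_mul, mul_sub, mul_one, sub_mul, Units.inv_mul]

theorem isTriangular_conj_letterUnit (u : σ → (NCSeries σ)ˣ) :
    IsTriangular fun h => (((u h)⁻¹ * letterUnit h * u h : (NCSeries σ)ˣ) : NCSeries σ) - 1 where
  coeff_eq_zero h c hc := by
    have hX : ∀ d, d.Sublist c → (X h : NCSeries σ).coeff d = 0 := fun d hd => by
      rw [coeff_X, if_neg]
      rintro rfl
      exact hc (List.singleton_sublist.1 hd)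
    have hdvd := dvd_coeff_conj_sub (M := 0) (fun d hd _ => zero_dvd_iff.2 (hX d hd)) (u h)
    rw [zero_dvd_iff, hX c (List.Sublist.refl c), sub_zero] at hdvd
    rw [val_conj_sub_one, letterUnit_sub_one, hdvd]
  coeff_singleton h := by
    have hdvd := dvd_coeff_conj_sub (M := 0) (f := X h) (c := [h])
      (fun d _ hd => by rw [coeff_X, if_neg hd]) (u h)
    rw [zero_dvd_iff, sub_eq_zero, coeff_X, if_pos rfl] at hdvd
    rw [val_conj_sub_one, letterUnit_sub_one, hdvd]

/-- Conjugation of `g` does not change the coefficient of `c`, because those of the proper subwords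
of `c` are divisible by `M`. -/
theorem dvd_coeff_sub_wordVal_letterUnit {g v : (NCSeries σ)ˣ} {u : σ → (NCSeries σ)ˣ}
    {l : List (σ × Bool)} (hg : ∀ d, d.Sublist c → d ≠ c → M ∣ ((g : NCSeries σ) - 1).coeff d)
    (hw : ∀ d, d.Sublist c → M ∣ (((v⁻¹ * g * v : (NCSeries σ)ˣ) : NCSeries σ) -
      (wordVal (fun h => (u h)⁻¹ * letterUnit h * u h) l : (NCSeries σ)ˣ)).coeff d) :
    M ∣ ((g : NCSeries σ) - (wordVal letterUnit l : (NCSeries σ)ˣ)).coeff c := by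
  set w := wordVal (fun h => (u h)⁻¹ * letterUnit h * u h) l
  have hconj (d) (hd : d.Sublist c) :
      M ∣ ((g : NCSeries σ) - (v⁻¹ * g * v : (NCSeries σ)ˣ)).coeff d := by
    rw [← sub_sub_sub_cancel_right _ _ 1, val_conj_sub_one, coeff_sub, dvd_sub_comm]
    exact dvd_coeff_conj_sub (fun e he hed => hg e (he.trans hd) fun hec =>
      hed (he.antisymm (hec ▸ hd))) v
  have hgw (d) (hd : d.Sublist c) : M ∣ ((g : NCSeries σ) - (w : NCSeries σ)).coeff d := by
    rw [← sub_add_sub_cancel, coeff_add]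
    exact dvd_add (hconj d hd) (hw d hd)
  have hexp : M ∣ ((w : NCSeries σ) - (wordVal letterUnit l : (NCSeries σ)ˣ)).coeff c := by
    refine (isTriangular_conj_letterUnit u).dvd_coeff_wordVal_sub fun d hd hdc => ?_
    rw [show (w : NCSeries σ) - 1 = ((g : NCSeries σ) - 1) - (g - w) by abel, coeff_sub]
    exact dvd_sub (hg d hd hdc) (hgw d hd)
  rw [← sub_add_sub_cancel, coeff_add]
  exact dvd_add (hgw c (List.Sublist.refl c)) hexp

end Conjugation

theorem coeff_magnusPhi_nil {n : ℕ} (l : List (Fin n × Bool)) : (magnusPhi l).coeff [] = 1 := by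
  induction l with
  | nil => rfl
  | cons a l ih =>
    rw [← List.singleton_append, magnusPhi_append, coeff_mul_nil, ih, mul_one]
    obtain ⟨h, b⟩ := a
    cases b
    · simpa [magnusPhi] using altGeom_nil h
    · simp [magnusPhi, coeff_add, coeff_one, coeff_X]

theorem val_wordVal_letterUnit {n : ℕ} (l : List (Fin n × Bool)) :
    ((wordVal letterUnit l : (NCSeries (Fin n))ˣ) : NCSeries (Fin n)) = magnusPhi l := by
  induction l with
  | nil => rfl
  | cons a l ih =>
    obtain ⟨h, b⟩ := a
    rw [← List.singleton_append, wordVal_append, Units.val_mul, ih, magnusPhi_append,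
      wordVal_singleton]
    cases b <;> simp [magnusPhi, letterUnit, signPow]

end NCSeries

namespace PeripheralSystem

variable {G : Type*} [Group G] {n : ℕ}

/-- The peripheral system with given data for the components of a phrase. A system has
entries at all natural numbers; they are trivial at the indices that belong to no component. -/
def ofFin (N : Fin n → Subgroup G) [∀ i, (N i).Normal]
    (hN : ∀ i, ∀ g ∈ N i, ∀ h ∈ N i, Commute g h) (m l : Fin n → G) (hm : ∀ i, m i ∈ N i)
    (hml : ∀ i, Commute (m i) (l i)) : PeripheralSystem G where
  meridianSubgroup k := if hk : k < n then N ⟨k, hk⟩ else ⊥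
  normal k := by split_ifs <;> infer_instance
  commute k := by
    split_ifs with hk
    · exact hN ⟨k, hk⟩
    · simp
  meridian k := if hk : k < n then m ⟨k, hk⟩ else 1
  meridian_mem k := by
    split_ifs with hk
    · exact hm ⟨k, hk⟩
    · exact one_mem _
  longitude k := if hk : k < n then l ⟨k, hk⟩ else 1
  commute_longitude k := by
    split_ifs with hk
    · exact hml ⟨k, hk⟩
    · exact Commute.one_left 1

end PeripheralSystem

/-! ### Cyclic permutations of subsequences -/

section LowerWords

variable {α : Type*} {s d e : List α}

theorem exists_sublist_isRotated {d' : List α} (h : e.Sublist d) (hd : d.IsRotated d') :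
    ∃ e', e'.Sublist d' ∧ e.IsRotated e' := by
  obtain ⟨k, hk, rfl⟩ := List.isRotated_iff_mod.1 hd
  rw [← List.take_append_drop k d] at h
  obtain ⟨e₁, e₂, rfl, h₁, h₂⟩ := List.sublist_append_iff.1 h
  exact ⟨e₂ ++ e₁, List.rotate_eq_drop_append_take hk ▸ h₂.append h₁, List.isRotated_append⟩

/-- The cyclic permutations of the proper subsequences of `s`, of any length: these are the
monomials whose coefficients are controlled by the numbers `μ` below that of `s`. -/
def lowerWords (s : List α) : Set (List α) :=
  {d | ∃ d', d'.Sublist s ∧ d'.length < s.length ∧ d.IsRotated d'}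

theorem mem_lowerWords_of_sublist (hd : d ∈ lowerWords s) (h : e.Sublist d) : e ∈ lowerWords s := by
  obtain ⟨d', hsub, hlen, hrot⟩ := hd
  obtain ⟨e', hsub', hrot'⟩ := exists_sublist_isRotated h hrot
  exact ⟨e', hsub'.trans hsub, hsub'.length_le.trans_lt hlen, hrot'⟩

theorem mem_lowerWords_of_isRotated (hd : d ∈ lowerWords s) (h : e.IsRotated d) :
    e ∈ lowerWords s := by
  obtain ⟨d', hsub, hlen, hrot⟩ := hd
  exact ⟨d', hsub, hlen, h.trans hrot⟩

theorem factorClosed_lowerWords (s : List α) : FactorClosed (lowerWords s) :=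
  fun _ hc k => ⟨mem_lowerWords_of_sublist hc (List.take_sublist k _),
    mem_lowerWords_of_sublist hc (List.drop_sublist k _)⟩

theorem nodup_of_mem_lowerWords (hs : s.Nodup) (hd : d ∈ lowerWords s) : d.Nodup := by
  obtain ⟨d', hsub, -, hrot⟩ := hd
  exact hrot.nodup_iff.2 (hs.sublist hsub)

theorem length_lt_of_mem_lowerWords (hd : d ∈ lowerWords s) : d.length < s.length := by
  obtain ⟨d', -, hlen, hrot⟩ := hd
  rwa [hrot.perm.length_eq]

theorem mem_lowerWords_append_singleton {c : List α} {i : α} (hd : d.Sublist c) :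
    d ∈ lowerWords (c ++ [i]) :=
  ⟨d, hd.trans (List.sublist_append_left c [i]), by simpa [Nat.lt_succ_iff] using hd.length_le,
    List.IsRotated.refl d⟩

theorem append_singleton_mem_lowerWords {c : List α} {i : α} (hd : d.Sublist c) (hdc : d ≠ c) :
    d ++ [i] ∈ lowerWords (c ++ [i]) :=
  ⟨d ++ [i], hd.append (List.Sublist.refl [i]),
    by simpa using hd.length_le.lt_of_ne fun h => hdc (hd.eq_of_length h),
    List.IsRotated.refl _⟩

end LowerWords

/-! ### The Magnus expansion of the longitudes -/

namespace Nanophrase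

open NCSeries

variable {n : ℕ} {p q : Nanophrase AlphaV n} {s c : List (Fin n)} {i : Fin n} {M : ℤ}

theorem mem_lowerSeqs {d : List (Fin n)} :
    d ∈ lowerSeqs s ↔ d ∈ lowerWords s ∧ 2 ≤ d.length := by
  simp only [lowerSeqs, Finset.mem_biUnion, Finset.mem_filter, List.mem_toFinset,
    List.mem_sublists, List.mem_cyclicPermutations_iff, lowerWords, Set.mem_ofPred_eq]
  constructor
  · rintro ⟨d', ⟨hsub, htwo, hlen⟩, hrot⟩
    exact ⟨⟨d', hsub, hlen, hrot⟩, by rwa [hrot.perm.length_eq]⟩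
  · rintro ⟨⟨d', hsub, hlen, hrot⟩, htwo⟩
    exact ⟨d', ⟨hsub, by rwa [← hrot.perm.length_eq], hlen⟩, hrot⟩

theorem muSeq_append (p : Nanophrase AlphaV n) (c : List (Fin n)) (i : Fin n) :
    p.muSeq (c ++ [i]) = p.mu c i := by
  simp [muSeq]

/-- The expansion of the `i`th longitude, written by means of `ρ^{q+2}`. -/
noncomputable def longitudeUnit (p : Nanophrase AlphaV n) (q : ℕ) (i : Fin n) :
    (NCSeries (Fin n))ˣ :=
  wordVal letterUnit (p.eta (p.rho q (p.signedWord i)))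

theorem coeff_longitudeUnit {d : ℕ} (hd : c.length ≤ d) :
    (p.longitudeUnit d i : NCSeries (Fin n)).coeff c = p.mu c i := by
  rw [longitudeUnit, val_wordVal_letterUnit, mu_eq p c i hd]

theorem dvd_coeff_longitudeUnit_sub_one (hM : ∀ d ∈ lowerSeqs s, M ∣ p.muSeq d)
    (hc : c ++ [i] ∈ lowerWords s) :
    M ∣ ((p.longitudeUnit s.length i : NCSeries (Fin n)) - 1).coeff c := by
  have hlen := length_lt_of_mem_lowerWords hc
  rw [List.length_append, List.length_singleton] at hlen
  rcases eq_or_ne c [] with rfl | hne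
  · rw [longitudeUnit, val_wordVal_letterUnit, coeff_sub, coeff_magnusPhi_nil]
    exact dvd_zero M
  · have hpos := List.length_pos_iff.2 hne
    rw [coeff_sub, coeff_longitudeUnit (by lia), coeff_one, if_neg (by simpa using hne), sub_zero,
      ← muSeq_append]
    exact hM _ (mem_lowerSeqs.2 ⟨hc, by simp; lia⟩)

/-- The product in the other order is treated by a cyclic permutation of the monomials. -/
theorem commute_letterUnit_longitudeUnit (hM : ∀ d ∈ lowerSeqs s, M ∣ p.muSeq d) (h : Fin n) :
    Commute
      (letterUnit h : (NCSeries (Fin n))ˣ ⧸ unitsCongr (vanishing M (factorClosed_lowerWords s)))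
      (p.longitudeUnit s.length h) := by
  set g := p.longitudeUnit s.length h
  have hXg : X h * ((g : NCSeries (Fin n)) - 1) ∈ vanishing M (factorClosed_lowerWords s) := by
    refine mem_vanishing.2 fun c hc => dvd_coeff_mul fun k => ?_
    by_cases hk : c.take k = [h]
    · refine .inr <| dvd_coeff_longitudeUnit_sub_one hM <| mem_lowerWords_of_isRotated hc ?_
      rw [← hk]
      nth_rw 3 [← List.take_append_drop k c]
      exact List.isRotated_append
    · exact .inl (by rw [coeff_X, if_neg hk]; exact dvd_zero M)
  have hgX : ((g : NCSeries (Fin n)) - 1) * X h ∈ vanishing M (factorClosed_lowerWords s) := by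
    refine mem_vanishing.2 fun c hc => dvd_coeff_mul fun k => ?_
    by_cases hk : c.drop k = [h]
    · refine .inl <| dvd_coeff_longitudeUnit_sub_one hM ?_
      rwa [← hk, List.take_append_drop]
    · exact .inr (by rw [coeff_X, if_neg hk]; exact dvd_zero M)
  have hsub : ((letterUnit h * g : (NCSeries (Fin n))ˣ) : NCSeries (Fin n)) -
      (g * letterUnit h : (NCSeries (Fin n))ˣ) =
        X h * ((g : NCSeries (Fin n)) - 1) - ((g : NCSeries (Fin n)) - 1) * X h := by
    rw [← letterUnit_sub_one]
    push_cast
    noncomm_ring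
  exact mk_eq_mk_iff.2 (hsub ▸ TwoSidedIdeal.sub_mem _ hXg hgX)

/-- The elements `1 + κ_h` and the longitudes, modulo the numbers `μ` below that of `s`. The normal
closure of `1 + κ_h` is replaced by the units in whose nonconstant terms `κ_h` occurs, which commute
because `s` has no repetitions. -/
noncomputable def peripheralSystem (p : Nanophrase AlphaV n) (hs : s.Nodup)
    (hM : ∀ d ∈ lowerSeqs s, M ∣ p.muSeq d) :
    PeripheralSystem
      ((NCSeries (Fin n))ˣ ⧸ unitsCongr (vanishing M (factorClosed_lowerWords s))) :=
  PeripheralSystem.ofFin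
    (fun h => unitsCongrMod _ (vanishing M ((factorClosed_lowerWords s).avoiding h)))
    (fun _ _ hg _ hg' => commute_of_mem_unitsCongrMod (fun _ hx _ hy =>
      mul_mem_vanishing_of_avoiding (fun _ hc => nodup_of_mem_lowerWords hs hc) hx hy) hg hg')
    (fun h => letterUnit h) (fun h => p.longitudeUnit s.length h)
    (fun h => (mk_mem_unitsCongrMod (vanishing_le fun _ hc => hc.1)).2 <|
      mem_vanishing.2 fun c hc => by
        rw [letterUnit_sub_one, coeff_X, if_neg]
        · exact dvd_zero M
        · rintro rfl
          exact hc.2 (List.mem_singleton_self h))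
    (commute_letterUnit_longitudeUnit hM)

section PeripheralSystem

variable {hs : s.Nodup} {hM : ∀ d ∈ lowerSeqs s, M ∣ p.muSeq d}

theorem meridianSubgroup_peripheralSystem :
    (p.peripheralSystem hs hM).meridianSubgroup i =
      unitsCongrMod _ (vanishing M ((factorClosed_lowerWords s).avoiding i)) := by
  simp [peripheralSystem, PeripheralSystem.ofFin]

theorem meridian_peripheralSystem :
    (p.peripheralSystem hs hM).meridian i = (letterUnit i : (NCSeries (Fin n))ˣ) := by
  simp [peripheralSystem, PeripheralSystem.ofFin]

theorem longitude_peripheralSystem :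
    (p.peripheralSystem hs hM).longitude i = p.longitudeUnit s.length i := by
  simp [peripheralSystem, PeripheralSystem.ofFin]

end PeripheralSystem

theorem wordVal_mk {I : TwoSidedIdeal (NCSeries (Fin n))} {L : Type*}
    (E : L → (NCSeries (Fin n))ˣ) (l : List (L × Bool)) :
    wordVal (fun D => (E D : (NCSeries (Fin n))ˣ ⧸ unitsCongr I)) l = wordVal E l :=
  (map_wordVal (QuotientGroup.mk' (unitsCongr I)) l).symm

theorem exists_solves_peripheralSystem (hs : s.Nodup) (hM : ∀ d ∈ lowerSeqs s, M ∣ p.muSeq d) :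
    ∃ E, p.Solves (p.peripheralSystem hs hM) E := by
  refine ⟨_, solves_rhoVal (d := s.length) (fun _ => meridian_peripheralSystem) ?_ fun i => ?_⟩
  · funext D
    rw [rhoVal, rhoVal, wordVal_mk, wordVal_mk, mk_eq_mk_iff, val_wordVal_letterUnit,
      val_wordVal_letterUnit]
    refine mem_vanishing.2 fun c hc => ?_
    rw [coeff_sub, p.expansion_agree _ _ c (length_lt_of_mem_lowerWords hc).le, sub_self]
    exact dvd_zero M
  · rw [longitude_peripheralSystem, ← wordVal_eta_rho, wordVal_mk]
    rfl

theorem Solves.sub_wordVal_mem_vanishing {W : Set (List (Fin n))} {hW : FactorClosed W}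
    {P : PeripheralSystem ((NCSeries (Fin n))ˣ ⧸ unitsCongr (vanishing M hW))}
    {E : p.Letter → (NCSeries (Fin n))ˣ ⧸ unitsCongr (vanishing M hW)} (h : p.Solves P E)
    {m : Fin n → (NCSeries (Fin n))ˣ} (hm : ∀ k : Fin n, P.meridian k = m k)
    (hm_nil : ∀ k, ((m k : NCSeries (Fin n)) - 1).coeff [] = 0)
    (hi : P.meridianSubgroup i = unitsCongrMod _ (vanishing M (hW.avoiding i)))
    {g : (NCSeries (Fin n))ˣ} (hg : P.longitude i = g) {d : ℕ} (hd : ∀ c ∈ W, c.length ≤ d) :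
    (g : NCSeries (Fin n)) -
      (wordVal m (p.eta (p.rho d (p.signedWord i))) : (NCSeries (Fin n))ˣ) ∈
        vanishing M (hW.avoiding i) := by
  let Γ (q : ℕ) := unitsCongrMod (vanishing M hW) (vanishing M (hW.shorter q))
  have hm_mem (k : Fin n) : (m k : (NCSeries (Fin n))ˣ ⧸ unitsCongr (vanishing M hW)) ∈ Γ 1 :=
    (mk_mem_unitsCongrMod (vanishing_le fun _ hc => hc.1)).2 <| mem_vanishing.2 fun c hc => by
      rw [List.length_eq_zero_iff.1 (Nat.lt_one_iff.1 hc.2), hm_nil]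
      exact dvd_zero M
  have hΓ₀ : Γ 0 = ⊤ :=
    (congrArg _ (vanishing_shorter_zero (hW := hW))).trans unitsCongrMod_top
  have hΓ (q : ℕ) : ⁅Γ 1, Γ q⁆ ≤ Γ (q + 1) :=
    commutator_unitsCongrMod_le
      (fun _ hx _ hy => mul_mem_vanishing_of_shorter_one_left (hW := hW) hx hy)
      fun _ hy _ hx => mul_mem_vanishing_of_shorter_one_right (hW := hW) hy hx
  have hbot : Γ (d + 1) = ⊥ :=
    (congrArg _ (vanishing_shorter_of_length_lt (hW := hW)
      fun c hc => Nat.lt_succ_of_le (hd c hc))).trans unitsCongrMod_self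
  have happrox := h.mk_wordVal_rhoVal hm Γ hΓ₀ hm_mem hΓ d (l := p.signedWord i)
    isMixed_of_mem_signedWord
  rw [QuotientGroup.eq, hbot, Subgroup.mem_bot, inv_mul_eq_one, ← wordVal_eta_rho,
    wordVal_mk] at happrox
  set w := wordVal m (p.eta (p.rho d (p.signedWord i)))
  have hmem : ((w⁻¹ * g : (NCSeries (Fin n))ˣ) : (NCSeries (Fin n))ˣ ⧸ unitsCongr _) ∈
      unitsCongrMod (vanishing M hW) (vanishing M (hW.avoiding i)) := by
    rw [QuotientGroup.mk_mul, QuotientGroup.mk_inv, happrox, ← hg, ← hi]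
    exact (solves_iff_truncWord.1 h).2 i
  have hmul := TwoSidedIdeal.mul_mem_left _ (w : NCSeries (Fin n)) _
    ((mk_mem_unitsCongrMod (vanishing_le fun _ hc => hc.1)).1 hmem)
  rwa [Units.val_mul, mul_sub, mul_one, Units.mul_inv_cancel_left] at hmul

theorem dvd_mu_sub_mu_of_mMove (hpq : MMove virtualData p q) (hci : (c ++ [i]).Nodup)
    (hM : ∀ d ∈ lowerSeqs (c ++ [i]), M ∣ p.muSeq d) : M ∣ p.mu c i - q.mu c i := by
  have hic : i ∉ c := fun hic =>
    (List.nodup_append.1 hci).2.2 i hic i (List.mem_singleton_self i) rfl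
  obtain ⟨E, hE⟩ := exists_solves_peripheralSystem hci hM
  obtain ⟨u, E', hE'⟩ := hE.of_mMove hpq
  obtain ⟨u, rfl⟩ := (QuotientGroup.mk_surjective (s := unitsCongr _)).comp_left u
  set d := (c ++ [i]).length with hd
  have hcd : c.length ≤ d := by simp [hd]
  have hmem := hE'.sub_wordVal_mem_vanishing (i := i)
    (m := fun h => (u h)⁻¹ * letterUnit h * u h) (g := (u i)⁻¹ * p.longitudeUnit d i * u i)
    (fun h => by simp [PeripheralSystem.conj, meridian_peripheralSystem])
    (fun h => (isTriangular_conj_letterUnit fun h : Fin n => u h).coeff_eq_zero h []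
      List.not_mem_nil)
    (meridianSubgroup_peripheralSystem (hs := hci) (hM := hM))
    (by simp [PeripheralSystem.conj, longitude_peripheralSystem, d])
    fun _ he => (length_lt_of_mem_lowerWords he).le
  have hcoeff : M ∣ ((p.longitudeUnit d i : NCSeries (Fin n)) - q.longitudeUnit d i).coeff c :=
    dvd_coeff_sub_wordVal_letterUnit
      (fun e he hec => dvd_coeff_longitudeUnit_sub_one hM (append_singleton_mem_lowerWords he hec))
      fun e he => mem_vanishing.1 hmem e
        ⟨mem_lowerWords_append_singleton he, fun h => hic (he.subset h)⟩
  rwa [coeff_sub, coeff_longitudeUnit hcd, coeff_longitudeUnit hcd] at hcoeff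

end Nanophrase

/-! ### The numbers `Δ` and `μ̄` -/

namespace Nanophrase

variable {n : ℕ} {p q : Nanophrase AlphaV n} {c : List (Fin n)} {i : Fin n}

theorem lowerSeqs_subset {s d : List (Fin n)} (hd : d ∈ lowerSeqs s) :
    lowerSeqs d ⊆ lowerSeqs s := by
  intro e he
  rw [mem_lowerSeqs] at hd he ⊢
  obtain ⟨⟨e', hsub, -, hrot⟩, htwo⟩ := he
  exact ⟨mem_lowerWords_of_isRotated (mem_lowerWords_of_sublist hd.1 hsub) hrot, htwo⟩

theorem Delta_dvd_muSeq {d : List (Fin n)} (hd : d ∈ lowerSeqs (c ++ [i])) :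
    (p.Delta c i : ℤ) ∣ p.muSeq d :=
  Int.natAbs_dvd.2 (Finset.gcd_dvd hd)

theorem dvd_Delta {M : ℕ} (h : ∀ d ∈ lowerSeqs (c ++ [i]), (M : ℤ) ∣ p.muSeq d) :
    M ∣ p.Delta c i :=
  Int.natCast_dvd.1 (Finset.dvd_gcd h)

theorem Delta_dvd_Delta {e : List (Fin n)} {j : Fin n} (he : e ++ [j] ∈ lowerSeqs (c ++ [i])) :
    p.Delta c i ∣ p.Delta e j :=
  dvd_Delta fun _ hd => Delta_dvd_muSeq (lowerSeqs_subset he hd)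

theorem Delta_dvd_mu_sub_mu_of_mMove (hpq : MMove virtualData p q) (hci : (c ++ [i]).Nodup) :
    (p.Delta c i : ℤ) ∣ p.mu c i - q.mu c i :=
  dvd_mu_sub_mu_of_mMove hpq hci fun _ hd => Delta_dvd_muSeq hd

theorem exists_of_mem_lowerSeqs {d : List (Fin n)} (hd : d ∈ lowerSeqs (c ++ [i])) :
    ∃ e j, d = e ++ [j] ∧ e.length < c.length := by
  obtain ⟨hmem, htwo⟩ := mem_lowerSeqs.1 hd
  rcases List.eq_nil_or_concat' d with rfl | ⟨e, j, rfl⟩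
  · simp at htwo
  · exact ⟨e, j, rfl, by simpa using length_lt_of_mem_lowerWords hmem⟩

theorem Delta_eq_of_mMove (hpq : MMove virtualData p q) (hci : (c ++ [i]).Nodup) :
    p.Delta c i = q.Delta c i := by
  induction hk : c.length using Nat.strong_induction_on generalizing c i with
  | _ k ih =>
    have hlower (M : ℕ) (hM : M ∣ p.Delta c i ∨ M ∣ q.Delta c i) (d)
        (hd : d ∈ lowerSeqs (c ++ [i])) : (M : ℤ) ∣ p.muSeq d ↔ (M : ℤ) ∣ q.muSeq d := by
      obtain ⟨e, j, rfl, hlt⟩ := exists_of_mem_lowerSeqs hd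
      have hnd := nodup_of_mem_lowerWords hci (mem_lowerSeqs.1 hd).1
      have hM' : M ∣ p.Delta e j := hM.elim (·.trans (Delta_dvd_Delta hd)) fun h =>
        ih _ (hk ▸ hlt) hnd rfl ▸ h.trans (Delta_dvd_Delta hd)
      rw [muSeq_append, muSeq_append]
      exact dvd_iff_dvd_of_dvd_sub
        ((Int.natCast_dvd_natCast.2 hM').trans (Delta_dvd_mu_sub_mu_of_mMove hpq hnd))
    exact Nat.dvd_antisymm
      (dvd_Delta fun d hd => (hlower _ (.inl dvd_rfl) d hd).1 (Delta_dvd_muSeq hd))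
      (dvd_Delta fun d hd => (hlower _ (.inr dvd_rfl) d hd).2 (Delta_dvd_muSeq hd))

theorem muBar_eq_of_mMove (hpq : MMove virtualData p q) (hci : (c ++ [i]).Nodup) :
    p.muBar c i = q.muBar c i := by
  have hmu : (p.mu c i : ZMod (p.Delta c i)) = q.mu c i :=
    ((ZMod.intCast_eq_intCast_iff_dvd_sub _ _ _).2 (Delta_dvd_mu_sub_mu_of_mMove hpq hci)).symm
  rw [muBar, muBar, hmu, Delta_eq_of_mMove hpq hci]

end Nanophrase

theorem theorem3p1 {n : ℕ} (p p' : Nanophrase AlphaV n) (h : MHomotopic virtualData p p')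
    (c : List (Fin n)) (i : Fin n) (hci : (c ++ [i]).Nodup) :
    p.muBar c i = p'.muBar c i := by
  induction h with
  | rel p q hpq => exact Nanophrase.muBar_eq_of_mMove hpq hci
  | refl p => rfl
  | symm p q _ ih => exact ih.symm
  | trans p q r _ _ ih₁ ih₂ => exact ih₁.trans ih₂
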